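/- For $L\ge 0$ let $r=(L+1)^2$, and let $\mathcal H_{\le L}$ be the space of functions on the unit sphere $\mathbb S^2\subset\mathbb R^3$ spanned by the spherical harmonics (restrictions to $\mathbb S^2$ of complex homogeneous harmonic polynomials) of degree at most $L$. Let $K_L$ be its reproducing kernel in $L^2(\mathbb S^2,\sigma)$, where $\sigma$ is the surface measure with $\sigma(\mathbb S^2)=4\pi$. The Harmonic ensemble of $r$ points is the determinantal point process with kernel $K_L$: a random family of $r$ almost surely distinct points $x_1,\dots,x_r\in\mathbb S^2$ such that, for $1\le m\le r$ and pairwise disjoint measurable sets $D_1,\dots,D_m\subset\mathbb S^2$, $$\mathbb E\Big[\prod_{i=1}^m \#\{j: x_j\in D_i\}\Big]=\int_{D_1\times\cdots\times D_m}\det\big(K_L(y_i,y_j)\big)_{i,j=1}^m\,d\sigma(y_1)\cdots d\sigma(y_m).$$ Let $h:\mathbb S^3\to\mathbb S^2$, $h(a,b,c,d)=(a^2+b^2-c^2-d^2,\,2(ad+bc),\,2(bd-ac))$ be the Hopf fibration, whose fibre over each point is a great circle. Given the $x_i$ and an integer $k\ge1$, place on each fibre $h^{-1}(x_i)$ $k$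 equally spaced points, rotated along the fibre by a uniformly random phase, the $r$ phases being independent of each other and of the points $x_i$. Let $\omega_N\subset\mathbb S^3$ be the resulting configuration of $N=kr$ points $y_1,\dots,y_N$, and let $$E_0(\omega_N)=\sum_{i\ne j}\log\frac1{\|y_i-y_j\|}$$ be its logarithmic energy. If $k=\lfloor \sqrt r/\log r\rfloor$, then $E_0(\omega_N)$ is integrable and, as $L\to\infty$ (so that $N\to\infty$), $$\mathbb E\big[E_0(\omega_N)\big]=-\frac{N^2}{4}-\frac13 N\log N+\frac23 N\log\log N+O(N).$$ -/

import Mathlib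

namespace HopfLift

noncomputable section

/-- The unit sphere of `ℝ³`. -/
abbrev S2 : Type := Metric.sphere (0 : EuclideanSpace ℝ (Fin 3)) 1

/-- The unit sphere of `ℝ⁴`. -/
abbrev S3 : Type := Metric.sphere (0 : EuclideanSpace ℝ (Fin 4)) 1

/-- The surface measure on the two-dimensional unit sphere, of total mass `4π`. -/
def surfaceMeasure : MeasureTheory.Measure S2 :=
  (MeasureTheory.volume : MeasureTheory.Measure (EuclideanSpace ℝ (Fin 3))).toSphere

/-! ### Logarithmic energy -/

/-- The discrete logarithmic energy of a finite family of points: the sum over ordered pairs of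
different indices of `log (1 / ‖yᵢ - yⱼ‖)`. -/
def logEnergy {ι : Type*} [Fintype ι] [DecidableEq ι] (y : ι → S3) : ℝ :=
  ∑ p ∈ (Finset.univ : Finset ι).offDiag,
    Real.log (1 / ‖(y p.1 : EuclideanSpace ℝ (Fin 4)) - (y p.2 : EuclideanSpace ℝ (Fin 4))‖)

/-! ### The Hopf fibration and its fibres -/

lemma sum_sq_S2 (p : S2) : (p : EuclideanSpace ℝ (Fin 3)) 0 ^ 2
    + (p : EuclideanSpace ℝ (Fin 3)) 1 ^ 2 + (p : EuclideanSpace ℝ (Fin 3)) 2 ^ 2 = 1 := by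
  have h : ‖(p : EuclideanSpace ℝ (Fin 3))‖ ^ 2 = 1 := by
    rw [mem_sphere_zero_iff_norm.1 p.2]; norm_num
  rw [EuclideanSpace.norm_sq_eq] at h
  simpa [Fin.sum_univ_succ, ← add_assoc] using h

lemma sum_sq_S3 (q : S3) : (q : EuclideanSpace ℝ (Fin 4)) 0 ^ 2
    + (q : EuclideanSpace ℝ (Fin 4)) 1 ^ 2 + (q : EuclideanSpace ℝ (Fin 4)) 2 ^ 2
    + (q : EuclideanSpace ℝ (Fin 4)) 3 ^ 2 = 1 := by
  have h : ‖(q : EuclideanSpace ℝ (Fin 4))‖ ^ 2 = 1 := by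
    rw [mem_sphere_zero_iff_norm.1 q.2]; norm_num
  rw [EuclideanSpace.norm_sq_eq] at h
  simpa [Fin.sum_univ_succ, ← add_assoc] using h

/-- The Hopf map `h (a, b, c, d) = (a² + b² - c² - d², 2 (a d + b c), 2 (b d - a c))`. -/
def hopf (q : S3) : S2 :=
  let a := (q : EuclideanSpace ℝ (Fin 4)) 0
  let b := (q : EuclideanSpace ℝ (Fin 4)) 1
  let c := (q : EuclideanSpace ℝ (Fin 4)) 2
  let d := (q : EuclideanSpace ℝ (Fin 4)) 3
  ⟨!₂[a ^ 2 + b ^ 2 - c ^ 2 - d ^ 2, 2 * (a * d + b * c), 2 * (b * d - a * c)], by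
    have h : a ^ 2 + b ^ 2 + c ^ 2 + d ^ 2 = 1 := sum_sq_S3 q
    rw [mem_sphere_zero_iff_norm, EuclideanSpace.norm_eq, Real.sqrt_eq_one]
    simp only [Fin.sum_univ_three, Real.norm_eq_abs, sq_abs]
    simp
    linear_combination (a ^ 2 + b ^ 2 + c ^ 2 + d ^ 2 + 1) * h⟩

/-- The point with parameter `t` of the explicit parametrization of the fibre of the Hopf map over
`(p₁, p₂, p₃)`.  The formula for `p₁ ≠ -1` is undefined at `(-1, 0, 0)`; the fibre over that point
is the great circle `(0, 0, cos t, sin t)`. -/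
def fibreVec (p : S2) (t : ℝ) : EuclideanSpace ℝ (Fin 4) :=
  let p₁ := (p : EuclideanSpace ℝ (Fin 3)) 0
  let p₂ := (p : EuclideanSpace ℝ (Fin 3)) 1
  let p₃ := (p : EuclideanSpace ℝ (Fin 3)) 2
  if p₁ = -1 then !₂[0, 0, Real.cos t, Real.sin t]
  else (1 / Real.sqrt (2 * (1 + p₁))) •
    !₂[(1 + p₁) * Real.cos t, (1 + p₁) * Real.sin t,
      p₂ * Real.sin t - p₃ * Real.cos t, p₂ * Real.cos t + p₃ * Real.sin t]

lemma inv_sqrt_sq (p : S2) (h : (p : EuclideanSpace ℝ (Fin 3)) 0 ≠ -1) :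
    (1 / Real.sqrt (2 * (1 + (p : EuclideanSpace ℝ (Fin 3)) 0))) ^ 2
      * (2 * (1 + (p : EuclideanSpace ℝ (Fin 3)) 0)) = 1 := by
  have h1 := sum_sq_S2 p
  have h2 : 0 < 1 + (p : EuclideanSpace ℝ (Fin 3)) 0 := by
    rcases lt_trichotomy (1 + (p : EuclideanSpace ℝ (Fin 3)) 0) 0 with h3 | h3 | h3
    · nlinarith [sq_nonneg ((p : EuclideanSpace ℝ (Fin 3)) 1),
        sq_nonneg ((p : EuclideanSpace ℝ (Fin 3)) 2)]
    · exact absurd (by linarith) h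
    · exact h3
  rw [div_pow, Real.sq_sqrt (by linarith)]
  field_simp

/-- The point of the fibre over `p` with parameter `t`, as a point of the sphere. -/
def fibrePoint (p : S2) (t : ℝ) : S3 :=
  ⟨fibreVec p t, by
    have hp := sum_sq_S2 p
    have ht := Real.sin_sq_add_cos_sq t
    rw [mem_sphere_zero_iff_norm, EuclideanSpace.norm_eq, Real.sqrt_eq_one]
    simp only [Fin.sum_univ_four, Real.norm_eq_abs, sq_abs]
    unfold fibreVec
    by_cases h : (p : EuclideanSpace ℝ (Fin 3)) 0 = -1
    · simp [h]
    · have hs := inv_sqrt_sq p h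
      simp only [h, if_false]
      set s := 1 / Real.sqrt (2 * (1 + (p : EuclideanSpace ℝ (Fin 3)) 0))
      simp
      set x := (p : EuclideanSpace ℝ (Fin 3)) 0
      set y := (p : EuclideanSpace ℝ (Fin 3)) 1
      set z := (p : EuclideanSpace ℝ (Fin 3)) 2
      linear_combination hs + s ^ 2 * ((1 + x) ^ 2 + y ^ 2 + z ^ 2) * ht + s ^ 2 * hp⟩

/-- Every point `fibrePoint p t` lies on the Hopf fibre over `p`. -/
lemma hopf_fibrePoint (p : S2) (t : ℝ) : hopf (fibrePoint p t) = p := by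
  have hp := sum_sq_S2 p
  have ht := Real.sin_sq_add_cos_sq t
  apply Subtype.ext
  by_cases h : (p : EuclideanSpace ℝ (Fin 3)) 0 = -1
  · have h1 : (p : EuclideanSpace ℝ (Fin 3)) 1 = 0 := by
      rw [h] at hp
      nlinarith [sq_nonneg ((p : EuclideanSpace ℝ (Fin 3)) 1),
        sq_nonneg ((p : EuclideanSpace ℝ (Fin 3)) 2)]
    have h2 : (p : EuclideanSpace ℝ (Fin 3)) 2 = 0 := by
      rw [h] at hp
      nlinarith [sq_nonneg ((p : EuclideanSpace ℝ (Fin 3)) 1),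
        sq_nonneg ((p : EuclideanSpace ℝ (Fin 3)) 2)]
    ext i
    fin_cases i
    · simp [hopf, fibrePoint, fibreVec, h]; linarith
    · simp [hopf, fibrePoint, fibreVec, h, h1]
    · simp [hopf, fibrePoint, fibreVec, h, h2]
  · have hs := inv_sqrt_sq p h
    ext i
    unfold hopf fibrePoint fibreVec
    simp only [h, if_false]
    set s := 1 / Real.sqrt (2 * (1 + (p : EuclideanSpace ℝ (Fin 3)) 0))
    set x := (p : EuclideanSpace ℝ (Fin 3)) 0
    set y := (p : EuclideanSpace ℝ (Fin 3)) 1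
    set z := (p : EuclideanSpace ℝ (Fin 3)) 2
    fin_cases i
    · simp
      linear_combination x * hs + s ^ 2 * ((1 + x) ^ 2 - y ^ 2 - z ^ 2) * ht - s ^ 2 * hp
    · simp
      linear_combination y * hs + 2 * s ^ 2 * (1 + x) * y * ht
    · simp
      linear_combination z * hs + 2 * s ^ 2 * (1 + x) * z * ht

/-- The lift of the points `x₁, …, x_r` of the two-sphere with phases `θ₁, …, θ_r`: on the fibre
over each `xᵢ`, the `k` equally spaced points with parameters `θᵢ + 2πj/k`. -/
def hopfLift {r : ℕ} (k : ℕ) (x : Fin r → S2) (θ : Fin r → ℝ) : Fin r × Fin k → S3 :=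
  fun p => fibrePoint (x p.1) (θ p.1 + 2 * Real.pi * (p.2 : ℕ) / k)

/-- The law of `r` independent phases, each uniform on `[0, 2π)`. -/
def phaseLaw (r : ℕ) : MeasureTheory.Measure (Fin r → ℝ) :=
  MeasureTheory.Measure.pi fun _ =>
    ProbabilityTheory.cond MeasureTheory.volume (Set.Ico 0 (2 * Real.pi))

/-! ### Determinantal point processes -/

/-- `ρ` is the `m`-point intensity function, with respect to `μ`, of the process of `n` points with
law `P`: `𝔼 ∏ᵢ #(x ∩ Dᵢ) = ∫_{∏ Dᵢ} ρ dμᵐ` for pairwise disjoint measurable sets `D₁, …, D_m`, and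
`ρ` vanishes when two of its arguments coincide. -/
structure IsIntensity {Λ : Type*} [MeasurableSpace Λ] (μ : MeasureTheory.Measure Λ) {n : ℕ}
    (P : MeasureTheory.Measure (Fin n → Λ)) (m : ℕ) (ρ : (Fin m → Λ) → NNReal) : Prop where
  moment : ∀ D : Fin m → Set Λ, (∀ i, MeasurableSet (D i)) →
    Pairwise (fun i j => Disjoint (D i) (D j)) →
    ∫⁻ x, ∏ i, (({j : Fin n | x j ∈ D i}.ncard : ℕ) : ENNReal) ∂P =
      ∫⁻ y in Set.pi Set.univ D, (ρ y : ENNReal) ∂(MeasureTheory.Measure.pi fun _ : Fin m => μ)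
  diagonal : ∀ y : Fin m → Λ, ¬ Function.Injective y → ρ y = 0

/-- `P` is the law of a simple process of `n` points that is determinantal with kernel `K` with
respect to `μ`: for `1 ≤ m ≤ n` its `m`-point intensity function exists and is
`det (K (yᵢ, yⱼ))`. -/
structure IsDeterminantal {Λ : Type*} [MeasurableSpace Λ] (μ : MeasureTheory.Measure Λ)
    (K : Λ → Λ → ℂ) {n : ℕ} (P : MeasureTheory.Measure (Fin n → Λ)) : Prop where
  prob : MeasureTheory.IsProbabilityMeasure P
  simple_points : ∀ᵐ x ∂P, Function.Injective x
  measurable_kernel : Measurable (Function.uncurry K)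
  intensity : ∀ m : ℕ, 1 ≤ m → m ≤ n → ∃ ρ : (Fin m → Λ) → NNReal, IsIntensity μ P m ρ ∧
    ∀ y : Fin m → Λ, (((ρ y : NNReal) : ℝ) : ℂ) = (Matrix.of fun i j => K (y i) (y j)).det

/-! ### Spherical harmonics and the Harmonic ensemble -/

/-- Restriction of a complex polynomial in three variables to the two-sphere. -/
def restrictToSphere : MvPolynomial (Fin 3) ℂ →ₗ[ℂ] (S2 → ℂ) where
  toFun f := fun x => MvPolynomial.eval (fun i => (((x : EuclideanSpace ℝ (Fin 3)) i : ℝ) : ℂ)) f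
  map_add' f g := by ext x; simp
  map_smul' c f := by ext x; simp [MvPolynomial.smul_eval]

/-- The Laplacian on polynomials in three variables. -/
def laplacian : MvPolynomial (Fin 3) ℂ →ₗ[ℂ] MvPolynomial (Fin 3) ℂ :=
  ∑ i : Fin 3, (MvPolynomial.pderiv i).toLinearMap ∘ₗ (MvPolynomial.pderiv i).toLinearMap

/-- The spherical harmonics of degree `l`: restrictions to the sphere of the harmonic homogeneous
polynomials of degree `l`. -/
def sphericalHarmonics (l : ℕ) : Submodule ℂ (S2 → ℂ) :=
  (MvPolynomial.homogeneousSubmodule (Fin 3) ℂ l ⊓ LinearMap.ker laplacian).map restrictToSphere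

/-- The space spanned by all spherical harmonics of degree at most `L`. -/
def harmonicSpace (L : ℕ) : Submodule ℂ (S2 → ℂ) :=
  ⨆ l ∈ Finset.range (L + 1), sphericalHarmonics l

/-- `K` is the reproducing kernel of the space `H` of functions in `L²(μ)`, that is, the integral
kernel of the orthogonal projection onto `H`: every `K(·, x)` is in `H`, and
`f(x) = ⟨f, K(·, x)⟩` for `f ∈ H`. -/
structure IsReproducingKernel {Λ : Type*} [MeasurableSpace Λ] (μ : MeasureTheory.Measure Λ)
    (H : Submodule ℂ (Λ → ℂ)) (K : Λ → Λ → ℂ) : Prop where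
  mem : ∀ x, (fun y => K y x) ∈ H
  reproducing : ∀ f ∈ H, ∀ x, f x = ∫ y, f y * (starRingEnd ℂ) (K y x) ∂μ

/-- `P` is the law of the Harmonic ensemble of `(L+1)²` points on the two-sphere: the determinantal
point process whose kernel is that of the projection onto the spherical harmonics of degree at most
`L`. -/
def IsHarmonicEnsemble (L : ℕ) (P : MeasureTheory.Measure (Fin ((L + 1) ^ 2) → S2)) : Prop :=
  ∃ K : S2 → S2 → ℂ, IsReproducingKernel surfaceMeasure (harmonicSpace L) K ∧
    IsDeterminantal surfaceMeasure K P

/-! ### Parameters -/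

/-- The number `r = (L+1)²` of points on the two-sphere. -/
def numBase (L : ℕ) : ℕ := (L + 1) ^ 2

/-- The number `k = ⌊√r / log r⌋` of points on each fibre. -/
def numFibre (L : ℕ) : ℕ := ⌊Real.sqrt (numBase L) / Real.log (numBase L)⌋₊

/-- The number `N = k r` of points on the three-sphere. -/
def numPoints (L : ℕ) : ℕ := numFibre L * numBase L

end

end HopfLift

namespace HopfLift

/-! The phases are averaged first. For a fixed point y of the three-sphere, the distance from y to
the point of parameter t on the fibre over p equals a distance in the plane, from a moving point of
a circle of radius α to a fixed point b of the closed disc it bounds. Here α² = 1 + w, where w is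
half the chordal distance between p and `hopf y`. By Jensen's formula the mean of the logarithm of
this distance is log α (`integral_log_fibrePoint`). So two different fibres contribute -k² log(1 +
w) over their ordered pairs of points in both directions, while a single fibre contributes the
energy -k log k of the k-th roots of unity. This gives (`integral_logEnergy_hopfLift`) the exact
value -r k log k - (k²/2) S, where S is the expected sum of log(1 + |x_i - x_j|/2) over ordered
pairs i ≠ j.

S is a pair statistic of a determinantal process, with two-point density K(x,x)² - K(x,y)². The
kernel is forced to be zonal by uniqueness and rotation invariance (`kernel_eq_zonal`), with K(x,x)
= r/(4π). The mean of log(1 + w) over the sphere is 1/2, so the first term yields r²/2, hence -N²/4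
in the energy. The second term is O(L log L): log(1 + w) ≤ w, and the square of the kernel
integrated against w is controlled by the Christoffel-Darboux identity and by Parseval for the
Fourier coefficients of P_n(cos θ) (`integral_zonal_sq_mul_sqrt_le`).

The choice of k balances the errors: k² L log L = O(kr) = O(N) because k ≤ √r / log r, and log k =
(1/3) log N - (2/3) log log N + O(1) turns -N log k into the remaining terms. -/

open Polynomial in
/-- The Legendre polynomials, by their three-term recurrence. -/
noncomputable def legendre : ℕ → ℝ[X]
  | 0 => 1
  | 1 => X
  | n + 2 => C (1 / ((n : ℝ) + 2)) *
      ((2 * (n : ℝ[X]) + 3) * X * legendre (n + 1) - ((n : ℝ[X]) + 1) * legendre n)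

/-! ### Legendre polynomials, orthogonality and the zonal kernel profile. -/

section Legendre

open Polynomial

lemma legendre_zero : legendre 0 = 1 := by rw [legendre]

lemma legendre_one : legendre 1 = X := by rw [legendre]

lemma legendre_rec (n : ℕ) : ((n : ℝ[X]) + 2) * legendre (n + 2) =
    (2 * (n : ℝ[X]) + 3) * X * legendre (n + 1) - ((n : ℝ[X]) + 1) * legendre n := by
  have h : ((n : ℝ[X]) + 2) * C (1 / ((n : ℝ) + 2)) = 1 := by
    have : ((n : ℝ[X]) + 2) = C ((n : ℝ) + 2) := by
      simp only [map_add, map_natCast, map_ofNat]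
    rw [this, ← C_mul, mul_one_div_cancel (by positivity), C_1]
  rw [legendre, ← mul_assoc, h, one_mul]

lemma eq_of_natCast_add_two_mul {n : ℕ} {p q : ℝ[X]}
    (h : ((n : ℝ[X]) + 2) * p = ((n : ℝ[X]) + 2) * q) : p = q := by
  have : ((n : ℝ[X]) + 2) ≠ 0 := by
    have : ((n : ℝ[X]) + 2) = C ((n : ℝ) + 2) := by
      simp only [map_add, map_natCast, map_ofNat]
    rw [this, Ne, C_eq_zero]
    positivity
  exact mul_left_cancel₀ this h

/-- Neither relation propagates alone: differentiating the recurrence leaves a combination that the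
second relation at n simplifies, so the two are proved jointly. -/
lemma derivative_legendre_aux (n : ℕ) :
    derivative (legendre (n + 1)) = X * derivative (legendre n) + ((n : ℝ[X]) + 1) * legendre n ∧
    X * derivative (legendre (n + 1)) - derivative (legendre n) =
      ((n : ℝ[X]) + 1) * legendre (n + 1) := by
  induction n with
  | zero => simp [legendre_zero, legendre_one]
  | succ n ih =>
    obtain ⟨hA, hB⟩ := ih
    have hr := legendre_rec n
    have hd := congrArg derivative hr
    simp only [derivative_mul, derivative_add, derivative_natCast, derivative_sub, derivative_X,
      derivative_ofNat, derivative_one] at hd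
    have hA' : derivative (legendre (n + 2)) =
        X * derivative (legendre (n + 1)) + ((n : ℝ[X]) + 2) * legendre (n + 1) := by
      apply eq_of_natCast_add_two_mul (n := n)
      linear_combination hd + ((n : ℝ[X]) + 1) * hB
    refine ⟨?_, ?_⟩
    · rw [hA']; push_cast; ring
    · push_cast
      rw [hA']
      linear_combination X * hB - hA - hr

/-- `P_{n+1}' = t P_n' + (n + 1) P_n`. -/
lemma derivative_legendre_succ (n : ℕ) : derivative (legendre (n + 1)) =
    X * derivative (legendre n) + ((n : ℝ[X]) + 1) * legendre n :=
  (derivative_legendre_aux n).1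

/-- `t P_{n+1}' - P_n' = (n + 1) P_{n+1}`. -/
lemma X_mul_derivative_legendre_succ (n : ℕ) :
    X * derivative (legendre (n + 1)) - derivative (legendre n) =
      ((n : ℝ[X]) + 1) * legendre (n + 1) :=
  (derivative_legendre_aux n).2

/-- The Christoffel-Darboux identity at the endpoint `1`. -/
lemma one_sub_X_mul_derivative_legendre (n : ℕ) :
    (1 - X) * (derivative (legendre n) + derivative (legendre (n + 1))) =
      ((n : ℝ[X]) + 1) * (legendre n - legendre (n + 1)) := by
  linear_combination derivative_legendre_succ n - X_mul_derivative_legendre_succ n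

/-- The Legendre differential equation. -/
lemma legendre_ode (n : ℕ) : derivative ((1 - X ^ 2) * derivative (legendre n)) =
    -((n : ℝ[X]) * ((n : ℝ[X]) + 1)) * legendre n := by
  cases n with
  | zero => simp [legendre_zero]
  | succ n =>
    have hA := derivative_legendre_succ n
    have hB := X_mul_derivative_legendre_succ n
    have h : (1 - X ^ 2) * derivative (legendre (n + 1)) =
        -((n : ℝ[X]) + 1) * (X * legendre (n + 1) - legendre n) := by
      linear_combination -X * hB + hA
    rw [h]
    simp only [derivative_mul, derivative_add, derivative_natCast, derivative_sub, derivative_X,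
      derivative_one, derivative_neg]
    push_cast
    linear_combination -((n : ℝ[X]) + 1) * hB

lemma eval_one_legendre (n : ℕ) : (legendre n).eval 1 = 1 ∧ (legendre (n + 1)).eval 1 = 1 := by
  induction n with
  | zero => simp [legendre_zero, legendre_one]
  | succ n ih =>
    refine ⟨ih.2, ?_⟩
    have h := congrArg (eval 1) (legendre_rec n)
    simp [ih.1, ih.2] at h
    have h2 : (n : ℝ) + 2 ≠ 0 := by positivity
    apply mul_left_cancel₀ h2
    linarith

lemma eval_neg_one_legendre (n : ℕ) :
    (legendre n).eval (-1) = (-1) ^ n ∧ (legendre (n + 1)).eval (-1) = (-1) ^ (n + 1) := by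
  induction n with
  | zero => simp [legendre_zero, legendre_one]
  | succ n ih =>
    refine ⟨ih.2, ?_⟩
    have h := congrArg (eval (-1)) (legendre_rec n)
    simp [ih.1, ih.2] at h
    have h2 : (n : ℝ) + 2 ≠ 0 := by positivity
    apply mul_left_cancel₀ h2
    rw [h]
    ring

lemma natDegree_legendre_le (n : ℕ) :
    (legendre n).natDegree ≤ n ∧ (legendre (n + 1)).natDegree ≤ n + 1 := by
  induction n with
  | zero => simp [legendre_zero, legendre_one]
  | succ n ih =>
    refine ⟨ih.2, ?_⟩
    rw [legendre]
    refine (natDegree_C_mul_le _ _).trans ((natDegree_sub_le _ _).trans (max_le ?_ ?_))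
    · refine natDegree_mul_le.trans ?_
      have : ((2 * (n : ℝ[X]) + 3) * X).natDegree ≤ 1 := by
        have e : (2 * (n : ℝ[X]) + 3) * X = C (2 * (n : ℝ) + 3) * X := by
          simp only [map_add, map_mul, map_natCast, map_ofNat]
        rw [e]
        exact (natDegree_C_mul_le _ _).trans natDegree_X_le
      omega
    · have e : ((n : ℝ[X]) + 1) = C ((n : ℝ) + 1) := by simp
      rw [e]
      exact (natDegree_C_mul_le _ _).trans (by omega)

/-- The integral of a polynomial over `[-1, 1]`, as a linear functional. -/
noncomputable def integralPoly : ℝ[X] →ₗ[ℝ] ℝ where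
  toFun p := ∫ t in (-1 : ℝ)..1, p.eval t
  map_add' p q := by
    simp only [eval_add]
    exact intervalIntegral.integral_add (p.continuous.intervalIntegrable _ _)
      (q.continuous.intervalIntegrable _ _)
  map_smul' c p := by simp

lemma integralPoly_apply (p : ℝ[X]) : integralPoly p = ∫ t in (-1 : ℝ)..1, p.eval t := rfl

lemma integralPoly_derivative (p : ℝ[X]) :
    integralPoly (derivative p) = p.eval 1 - p.eval (-1) :=
  intervalIntegral.integral_eq_sub_of_hasDerivAt (fun t _ => p.hasDerivAt t)
    ((derivative p).continuous.intervalIntegrable _ _)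

lemma integralPoly_by_parts (p q : ℝ[X]) : integralPoly (derivative p * q) =
    (p * q).eval 1 - (p * q).eval (-1) - integralPoly (p * derivative q) := by
  rw [← integralPoly_derivative, derivative_mul, map_add]
  ring

lemma integralPoly_legendre_mul_X_pow (n m : ℕ) (hm : m < n) :
    integralPoly (legendre n * X ^ m) = 0 := by
  induction m using Nat.strong_induction_on with
  | _ m ih =>
    have e1 : integralPoly (derivative ((1 - X ^ 2) * derivative (legendre n)) * X ^ m) =
        -((n : ℝ) * (n + 1)) * integralPoly (legendre n * X ^ m) := by
      have : -((n : ℝ[X]) * ((n : ℝ[X]) + 1)) * legendre n * X ^ m =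
          (-((n : ℝ) * (n + 1))) • (legendre n * X ^ m) := by
        rw [smul_eq_C_mul]
        simp only [map_add, map_mul, map_neg, map_natCast, map_one]
        ring
      rw [legendre_ode, this, map_smul, smul_eq_mul]
    have e2 : integralPoly (derivative ((1 - X ^ 2) * derivative (legendre n)) * X ^ m) =
        -integralPoly (derivative (legendre n) * ((1 - X ^ 2) * derivative (X ^ m))) := by
      rw [integralPoly_by_parts]
      simp
      congr 1
      ring
    rw [e1, integralPoly_by_parts] at e2
    simp only [eval_mul, eval_sub, eval_one, eval_pow, eval_X] at e2
    -- The Legendre operator is symmetric, as 1 - X² kills the boundary terms. Applied to X^m it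
    -- gives -m(m+1) X^m plus a multiple of X^(m-2), whose integral against P_n vanishes by
    -- induction; different eigenvalues then force the moment to be zero.
    have hne : ((n : ℝ) * (n + 1) - m * (m + 1)) ≠ 0 := by
      have : (m : ℝ) + 1 ≤ n := by exact_mod_cast hm
      have h0 : (0 : ℝ) ≤ m := by positivity
      nlinarith
    apply (mul_eq_zero.1 _).resolve_left hne
    match m with
    | 0 => 
      simp at e2
      simp
      rcases e2 with h | h
      · have : (0 : ℝ) < n := by exact_mod_cast hm
        rcases h with h | h
        · left; left; exact_mod_cast h
        · linarith
      · right; exact h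
    | 1 =>
      have hd : derivative ((1 - X ^ 2) * derivative (X ^ 1 : ℝ[X])) = C (-2) * X ^ 1 := by
        simp only [map_neg, map_ofNat, derivative_mul, derivative_sub, derivative_one,
          derivative_X_pow, pow_one, derivative_X]
        simp
        exact map_ofNat C 2
      rw [hd] at e2
      have : legendre n * (C (-2) * X ^ 1) = (-2 : ℝ) • (legendre n * X ^ 1) := by
        rw [smul_eq_C_mul]; ring
      rw [this, map_smul, smul_eq_mul] at e2
      push_cast
      linarith
    | m + 2 =>
      have hd : derivative ((1 - X ^ 2) * derivative (X ^ (m + 2) : ℝ[X])) =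
          C (((m : ℝ) + 2) * (m + 1)) * X ^ m - C (((m : ℝ) + 2) * (m + 3)) * X ^ (m + 2) := by
        simp only [map_add, map_mul, map_natCast, map_ofNat, map_one]
        simp only [derivative_mul, derivative_sub, derivative_one, derivative_X_pow,
          map_natCast, derivative_natCast]
        push_cast
        ring
      rw [hd] at e2
      have : legendre n * (C (((m : ℝ) + 2) * (m + 1)) * X ^ m
            - C (((m : ℝ) + 2) * (m + 3)) * X ^ (m + 2)) =
          (((m : ℝ) + 2) * (m + 1)) • (legendre n * X ^ m)
            - (((m : ℝ) + 2) * (m + 3)) • (legendre n * X ^ (m + 2)) := by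
        rw [smul_eq_C_mul, smul_eq_C_mul]; ring
      rw [this, map_sub, map_smul, map_smul, smul_eq_mul, smul_eq_mul,
        ih m (by omega) (by omega)] at e2
      push_cast
      linarith

/-- `P_n` is orthogonal to the polynomials of smaller degree. -/
lemma integralPoly_legendre_mul (n : ℕ) (q : ℝ[X]) (hq : q.natDegree < n) :
    integralPoly (legendre n * q) = 0 := by
  rw [q.as_sum_range' n hq, Finset.mul_sum, map_sum]
  refine Finset.sum_eq_zero fun m hm => ?_
  rw [← C_mul_X_pow_eq_monomial, mul_left_comm, ← smul_eq_C_mul, map_smul,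
    integralPoly_legendre_mul_X_pow n m (Finset.mem_range.1 hm), smul_zero]

/-- The zonal profile of `4π` times the reproducing kernel of degree at most `L`. -/
noncomputable def zonal (L : ℕ) : ℝ[X] :=
  derivative (legendre L) + derivative (legendre (L + 1))

lemma natDegree_zonal_le (L : ℕ) : (zonal L).natDegree ≤ L := by
  refine (natDegree_add_le _ _).trans (max_le ?_ ?_)
  · exact (natDegree_derivative_le _).trans (by have := (natDegree_legendre_le L).1; omega)
  · exact (natDegree_derivative_le _).trans (by have := (natDegree_legendre_le L).2; omega)

/-- The zonal profile reproduces the value at `1` of polynomials of degree at most `L`. -/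
lemma integralPoly_zonal_mul (L : ℕ) (q : ℝ[X]) (hq : q.natDegree ≤ L) :
    integralPoly (zonal L * q) = 2 * q.eval 1 := by
  have hz : integralPoly (zonal L * q) =
      integralPoly (derivative (legendre L + legendre (L + 1)) * q) := by
    rw [zonal, derivative_add]
  -- After integration by parts only the boundary term survives: P_L + P_{L+1} is 2 at 1 and 0 at
  -- -1, and both polynomials are orthogonal to q', which is zero or of degree less than L.
  have hq' : integralPoly (legendre L * derivative q) = 0 := by
    rcases Nat.eq_zero_or_pos q.natDegree with h | h
    · rw [natDegree_eq_zero.1 h |>.choose_spec.symm]; simp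
    · exact integralPoly_legendre_mul _ _ ((natDegree_derivative_lt h.ne').trans_le hq)
  have hq'' : integralPoly (legendre (L + 1) * derivative q) = 0 :=
    integralPoly_legendre_mul _ _ ((natDegree_derivative_le q).trans_lt (by omega))
  rw [hz, integralPoly_by_parts, add_mul, add_mul, map_add, hq', hq'']
  simp [(eval_one_legendre L).1, (eval_one_legendre L).2, (eval_neg_one_legendre L).1,
    (eval_neg_one_legendre L).2, pow_succ]
  ring

end Legendre

/-! ### Fourier expansion of P_n(cos θ) from the generating function. -/

section Fourier

/-- The coefficients of `(1 - z)^{-1/2}`. -/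
noncomputable def centralRatio (j : ℕ) : ℝ := (Nat.centralBinom j : ℝ) / 4 ^ j

lemma centralRatio_zero : centralRatio 0 = 1 := by simp [centralRatio]

lemma centralRatio_succ (j : ℕ) :
    ((j : ℝ) + 1) * centralRatio (j + 1) = ((j : ℝ) + 1 / 2) * centralRatio j := by
  have h : ((j : ℝ) + 1) * (Nat.centralBinom (j + 1) : ℝ) =
      2 * (2 * (j : ℝ) + 1) * (Nat.centralBinom j : ℝ) := by
    exact_mod_cast Nat.succ_mul_centralBinom_succ j
  unfold centralRatio
  rw [← mul_div_assoc, h, pow_succ]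
  field_simp
  ring

/-- The squared ratio of consecutive terms, ((j + 1/2)/(j + 1))², is at most (j + 1)/(j + 2). -/
lemma centralRatio_sq_le (j : ℕ) : centralRatio j ^ 2 ≤ 1 / ((j : ℝ) + 1) := by
  induction j with
  | zero => simp [centralRatio_zero]
  | succ j ih =>
    have h := centralRatio_succ j
    have e : centralRatio (j + 1) = ((j : ℝ) + 1 / 2) / ((j : ℝ) + 1) * centralRatio j := by
      field_simp
      linarith
    rw [e, mul_pow]
    refine (mul_le_mul_of_nonneg_left ih (by positivity)).trans ?_
    rw [div_pow, div_mul_div_comm, div_le_div_iff₀ (by positivity) (by positivity)]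
    push_cast
    have : (0 : ℝ) ≤ j := by positivity
    nlinarith

/-- The coefficients of `((1 - w z) (1 - v z))^{-1/2}` in `z`. -/
noncomputable def legendreExp (n : ℕ) (w v : ℂ) : ℂ :=
  ∑ p ∈ Finset.HasAntidiagonal.antidiagonal n,
    ((centralRatio p.1 * centralRatio p.2 : ℝ) : ℂ) * (w ^ p.1 * v ^ p.2)

-- The series is F = (1 - wz)^{-1/2}, characterized by the differential equation (1 - wz) F' = (w/2)
-- F; its coefficients satisfy `centralRatio_succ`.
open PowerSeries in
lemma one_sub_mul_derivative_centralRatio (w : ℂ) :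
    (1 - C w * X) * derivative ℂ (mk fun j => (centralRatio j : ℂ) * w ^ j) =
      C (w / 2) * mk fun j => (centralRatio j : ℂ) * w ^ j := by
  ext n
  have h : ∀ j : ℕ, ((j : ℂ) + 1) * (centralRatio (j + 1) : ℂ) =
      ((j : ℂ) + 1 / 2) * (centralRatio j : ℂ) := fun j => by
    have := congrArg Complex.ofReal (centralRatio_succ j)
    push_cast at this
    exact this
  rw [sub_mul, one_mul, mul_assoc, map_sub, coeff_C_mul, coeff_C_mul]
  cases n with
  | zero =>
    rw [coeff_zero_X_mul, coeff_derivative, coeff_mk, coeff_mk]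
    have := h 0
    simp at this ⊢
    linear_combination w * this
  | succ n =>
    rw [coeff_succ_X_mul, coeff_derivative, coeff_derivative, coeff_mk, coeff_mk]
    have := h (n + 1)
    push_cast at this ⊢
    linear_combination w ^ (n + 2) * this

open PowerSeries in
lemma legendreExp_rec (n : ℕ) (w v : ℂ) (hwv : w * v = 1) :
    ((n : ℂ) + 2) * legendreExp (n + 2) w v =
      (2 * (n : ℂ) + 3) * ((w + v) / 2) * legendreExp (n + 1) w v
        - ((n : ℂ) + 1) * legendreExp n w v := by
  set F : ℂ → PowerSeries ℂ := fun w => mk fun j => (centralRatio j : ℂ) * w ^ j with hF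
  have hG : ∀ n, coeff n (F w * F v) = legendreExp n w v := fun n => by
    rw [coeff_mul, legendreExp]
    refine Finset.sum_congr rfl fun p _ => ?_
    simp only [hF, coeff_mk]
    push_cast
    ring
  have hw := one_sub_mul_derivative_centralRatio w
  have hv := one_sub_mul_derivative_centralRatio v
  change (1 - C w * X) * derivative ℂ (F w) = C (w / 2) * F w at hw
  change (1 - C v * X) * derivative ℂ (F v) = C (v / 2) * F v at hv
  have hwv' : (C w : PowerSeries ℂ) * C v = 1 := by rw [← map_mul, hwv, map_one]
  have hw2 : (C w : PowerSeries ℂ) = C 2 * C (w / 2) := by rw [← map_mul]; congr 1; ring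
  have hv2 : (C v : PowerSeries ℂ) = C 2 * C (v / 2) := by rw [← map_mul]; congr 1; ring
  have hsum : (C (w + v) : PowerSeries ℂ) = C w + C v := map_add _ _ _
  have hsum2 : (C ((w + v) / 2) : PowerSeries ℂ) = C (w / 2) + C (v / 2) := by
    rw [← map_add]; congr 1; ring
  -- With wv = 1 the product G = F_w F_v is (1 - (w+v)z + z²)^{-1/2}, so (1 - (w+v)z + z²) G' =
  -- ((w+v)/2 - z) G. The coefficient of z^(n+1) is the Legendre recurrence.
  have key : derivative ℂ (F w * F v) - C (w + v) * (X * derivative ℂ (F w * F v))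
      + X * (X * derivative ℂ (F w * F v)) = C ((w + v) / 2) * (F w * F v) - X * (F w * F v) := by
    have hC : (C w * C (v / 2) + C v * C (w / 2) : PowerSeries ℂ) = 1 := by
      rw [← map_mul, ← map_mul, ← map_add, ← map_one C]; congr 1; linear_combination hwv
    rw [Derivation.leibniz, smul_eq_mul, smul_eq_mul, hsum, hsum2]
    linear_combination (1 - C v * X) * F v * hw + (1 - C w * X) * F w * hv
      - X * X * (F w * derivative ℂ (F v) + F v * derivative ℂ (F w)) * hwv'
      - X * F w * F v * hC
  have hc := congrArg (coeff (n + 1)) key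
  rw [map_add, map_sub, map_sub, coeff_C_mul, coeff_C_mul, coeff_succ_X_mul, coeff_succ_X_mul,
    coeff_succ_X_mul, coeff_derivative, coeff_derivative, hG, hG, hG] at hc
  cases n with
  | zero =>
    rw [coeff_zero_X_mul] at hc
    push_cast at hc ⊢
    linear_combination hc
  | succ n =>
    rw [coeff_succ_X_mul, coeff_derivative, hG] at hc
    push_cast at hc ⊢
    linear_combination hc

/-- The Fourier expansion of `P_n (cos θ)`. -/
lemma legendre_eval_eq_legendreExp (n : ℕ) (t : ℝ) (w v : ℂ) (hwv : w * v = 1)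
    (ht : w + v = 2 * t) : (((legendre n).eval t : ℝ) : ℂ) = legendreExp n w v ∧
    (((legendre (n + 1)).eval t : ℝ) : ℂ) = legendreExp (n + 1) w v := by
  induction n with
  | zero =>
    have h1 := centralRatio_succ 0
    simp [centralRatio_zero] at h1
    simp [legendre_zero, legendre_one, legendreExp, centralRatio_zero,
      Finset.Nat.antidiagonal_succ, h1]
    linear_combination -ht / 2
  | succ n ih =>
    refine ⟨ih.2, ?_⟩
    have h := congrArg (Polynomial.eval t) (legendre_rec n)
    have h' := legendreExp_rec n w v hwv
    have h2 : (n : ℂ) + 2 ≠ 0 := by exact_mod_cast (by positivity : (n : ℝ) + 2 ≠ 0)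
    apply mul_left_cancel₀ h2
    rw [h', ← ih.1, ← ih.2, ht]
    simp at h
    have h3 : ((n : ℂ) + 2) * (((legendre (n + 2)).eval t : ℝ) : ℂ) =
      (2 * n + 3) * t * (((legendre (n + 1)).eval t : ℝ) : ℂ) -
        (n + 1) * (((legendre n).eval t : ℝ) : ℂ) := by exact_mod_cast h
    rw [h3]
    ring

lemma integral_exp_int_mul (m : ℤ) :
    ∫ θ in (0 : ℝ)..2 * Real.pi, Complex.exp (m * Complex.I * θ) =
      if m = 0 then 2 * Real.pi else 0 := by
  split_ifs with h
  · simp [h]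
  · rw [integral_exp_mul_complex (by simp [h])]
    have : (m : ℂ) * Complex.I * ((2 * Real.pi : ℝ) : ℂ) = m * (2 * Real.pi * Complex.I) := by
      push_cast; ring
    rw [this, Complex.exp_int_mul_two_pi_mul_I]
    simp

/-- Parseval's identity for trigonometric polynomials. -/
lemma integral_norm_sq_trigPoly {ι : Type*} (s : Finset ι) (m : ι → ℤ)
    (hm : Set.InjOn m s) (c : ι → ℂ) :
    ∫ θ in (0 : ℝ)..2 * Real.pi, ‖∑ j ∈ s, c j * Complex.exp (m j * Complex.I * θ)‖ ^ 2 =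
      2 * Real.pi * ∑ j ∈ s, ‖c j‖ ^ 2 := by
  have h : ∀ θ : ℝ, ((‖∑ j ∈ s, c j * Complex.exp (m j * Complex.I * θ)‖ ^ 2 : ℝ) : ℂ) =
      ∑ i ∈ s, ∑ j ∈ s, c i * (starRingEnd ℂ) (c j) *
        Complex.exp (((m i - m j : ℤ) : ℂ) * Complex.I * θ) := fun θ => by
    rw [← Complex.normSq_eq_norm_sq, ← Complex.mul_conj, map_sum, Finset.sum_mul_sum]
    refine Finset.sum_congr rfl fun i _ => Finset.sum_congr rfl fun j _ => ?_
    rw [map_mul, ← Complex.exp_conj]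
    simp only [map_mul, Complex.conj_I, Complex.conj_ofReal, map_intCast]
    rw [mul_mul_mul_comm, ← Complex.exp_add]
    push_cast
    ring_nf
  have hi : ∀ i ∈ s, ∀ j ∈ s, IntervalIntegrable (fun θ : ℝ => c i * (starRingEnd ℂ) (c j) *
        Complex.exp (((m i - m j : ℤ) : ℂ) * Complex.I * θ)) MeasureTheory.volume
        0 (2 * Real.pi) := fun i _ j _ => by
    apply Continuous.intervalIntegrable
    fun_prop
  have : ((∫ θ in (0 : ℝ)..2 * Real.pi,
      ‖∑ j ∈ s, c j * Complex.exp (m j * Complex.I * θ)‖ ^ 2 : ℝ) : ℂ) =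
      ((2 * Real.pi * ∑ j ∈ s, ‖c j‖ ^ 2 : ℝ) : ℂ) := by
    rw [← intervalIntegral.integral_ofReal]
    simp_rw [h]
    rw [intervalIntegral.integral_finsetSum fun i hi' =>
      by simpa only [Finset.sum_fn] using IntervalIntegrable.sum s (hi i hi')]
    rw [Finset.mul_sum, Complex.ofReal_sum]
    refine Finset.sum_congr rfl fun i hi' => ?_
    rw [intervalIntegral.integral_finsetSum fun j hj => hi i hi' j hj]
    simp_rw [intervalIntegral.integral_const_mul, integral_exp_int_mul]
    rw [Finset.sum_eq_single i]
    · simp [Complex.mul_conj, Complex.normSq_eq_norm_sq]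
      ring
    · intro j hj hji
      rw [if_neg, Complex.ofReal_zero, mul_zero]
      intro h0
      exact hji (hm hj hi' (by omega))
    · exact fun h => absurd hi' h
  exact_mod_cast this

end Fourier

/-! ### Mean-square bounds for Legendre polynomials and for the kernel. -/

section FourierBounds

lemma legendre_cos (n : ℕ) (θ : ℝ) : (((legendre n).eval (Real.cos θ) : ℝ) : ℂ) =
    ∑ p ∈ Finset.HasAntidiagonal.antidiagonal n, ((centralRatio p.1 * centralRatio p.2 : ℝ) : ℂ) *
      Complex.exp ((((p.1 : ℤ) - (p.2 : ℤ) : ℤ) : ℂ) * Complex.I * θ) := by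
  have hwv : Complex.exp (θ * Complex.I) * Complex.exp (-(θ * Complex.I)) = 1 := by
    rw [← Complex.exp_add, add_neg_cancel, Complex.exp_zero]
  have ht : Complex.exp (θ * Complex.I) + Complex.exp (-(θ * Complex.I)) =
      2 * (Real.cos θ : ℂ) := by
    rw [Complex.ofReal_cos, Complex.cos]
    ring_nf
  rw [(legendre_eval_eq_legendreExp n _ _ _ hwv ht).1, legendreExp]
  refine Finset.sum_congr rfl fun p _ => ?_
  rw [← Complex.exp_nat_mul, ← Complex.exp_nat_mul, ← Complex.exp_add]
  push_cast
  ring_nf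

lemma legendre_deriv_cos (n : ℕ) (θ : ℝ) :
    (((Polynomial.derivative (legendre n)).eval (Real.cos θ) * Real.sin θ : ℝ) : ℂ) =
    ∑ p ∈ Finset.HasAntidiagonal.antidiagonal n,
      ((centralRatio p.1 * centralRatio p.2 : ℝ) : ℂ) *
        (-((((p.1 : ℤ) - (p.2 : ℤ) : ℤ) : ℂ) * Complex.I)) *
      Complex.exp ((((p.1 : ℤ) - (p.2 : ℤ) : ℤ) : ℂ) * Complex.I * θ) := by
  have h1 : HasDerivAt (fun θ : ℝ => (((legendre n).eval (Real.cos θ) : ℝ) : ℂ))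
      (((Polynomial.derivative (legendre n)).eval (Real.cos θ) * -Real.sin θ : ℝ) : ℂ) θ :=
    (((legendre n).hasDerivAt _).comp θ (Real.hasDerivAt_cos θ)).ofReal_comp
  have h2 : HasDerivAt (fun θ : ℝ => (((legendre n).eval (Real.cos θ) : ℝ) : ℂ))
      (∑ p ∈ Finset.HasAntidiagonal.antidiagonal n,
        ((centralRatio p.1 * centralRatio p.2 : ℝ) : ℂ) *
        (Complex.exp ((((p.1 : ℤ) - (p.2 : ℤ) : ℤ) : ℂ) * Complex.I * θ) *
          ((((p.1 : ℤ) - (p.2 : ℤ) : ℤ) : ℂ) * Complex.I))) θ := by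
    simp_rw [legendre_cos]
    refine HasDerivAt.fun_sum fun p _ => HasDerivAt.const_mul _ ?_
    have := ((hasDerivAt_id (θ : ℂ)).const_mul
      ((((p.1 : ℤ) - (p.2 : ℤ) : ℤ) : ℂ) * Complex.I)).cexp.comp_ofReal
    simpa using this
  have h := h1.unique h2
  rw [mul_neg, Complex.ofReal_neg, neg_eq_iff_eq_neg, ← Finset.sum_neg_distrib] at h
  rw [h]
  exact Finset.sum_congr rfl fun p _ => by ring

lemma injOn_antidiagonal_sub (n : ℕ) : Set.InjOn (fun p : ℕ × ℕ => (p.1 : ℤ) - (p.2 : ℤ))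
    (Finset.HasAntidiagonal.antidiagonal n : Finset (ℕ × ℕ)) := by
  intro p hp q hq h
  simp only [Finset.mem_coe, Finset.HasAntidiagonal.mem_antidiagonal] at hp hq
  simp only at h
  ext <;> omega

/-- For i + j = n, partial fractions split 1/((i+1)(j+1)) as (1/(i+1) + 1/(j+1))/(n+2), leaving two
harmonic sums. They are the source of the logarithm in the kernel estimate. -/
lemma sum_antidiagonal_centralRatio_le (n : ℕ) :
    ∑ p ∈ Finset.HasAntidiagonal.antidiagonal n, (centralRatio p.1 * centralRatio p.2) ^ 2 ≤
      2 / ((n : ℝ) + 2) * (1 + Real.log (n + 1)) := by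
  have hH : ∑ p ∈ Finset.HasAntidiagonal.antidiagonal n, 1 / ((p.1 : ℝ) + 1) ≤
      1 + Real.log (n + 1) := by
    have h := harmonic_le_one_add_log (n + 1)
    have e := Finset.Nat.sum_antidiagonal_eq_sum_range_succ (fun i _ : ℕ => 1 / ((i : ℝ) + 1)) n
    rw [e]
    unfold harmonic at h
    push_cast at h
    simpa [one_div] using h
  have hH' : ∑ p ∈ Finset.HasAntidiagonal.antidiagonal n, 1 / ((p.2 : ℝ) + 1) ≤
      1 + Real.log (n + 1) := by
    rw [← Finset.Nat.sum_antidiagonal_swap]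
    exact hH
  calc _ ≤ ∑ p ∈ Finset.HasAntidiagonal.antidiagonal n,
        1 / ((n : ℝ) + 2) * (1 / ((p.1 : ℝ) + 1) + 1 / ((p.2 : ℝ) + 1)) := by
        refine Finset.sum_le_sum fun p hp => ?_
        rw [mul_pow]
        refine (mul_le_mul (centralRatio_sq_le _) (centralRatio_sq_le _) (sq_nonneg _)
          (by positivity)).trans_eq ?_
        have : (n : ℝ) = p.1 + p.2 := by
          exact_mod_cast (Finset.HasAntidiagonal.mem_antidiagonal.1 hp).symm
        rw [this]
        field_simp
        ring
    _ ≤ _ := by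
        rw [← Finset.mul_sum, Finset.sum_add_distrib, div_mul_eq_mul_div, div_mul_eq_mul_div,
          one_mul]
        gcongr
        linarith

lemma integral_legendre_cos_sq_le (n : ℕ) :
    ∫ θ in (0 : ℝ)..2 * Real.pi, ((legendre n).eval (Real.cos θ)) ^ 2 ≤
      4 * Real.pi / (n + 2) * (1 + Real.log (n + 1)) := by
  have h : ∀ θ : ℝ, ((legendre n).eval (Real.cos θ)) ^ 2 =
      ‖(((legendre n).eval (Real.cos θ) : ℝ) : ℂ)‖ ^ 2 := fun θ => by
    rw [Complex.norm_real, Real.norm_eq_abs, sq_abs]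
  simp_rw [h, legendre_cos]
  rw [integral_norm_sq_trigPoly _ _ (injOn_antidiagonal_sub n)]
  simp_rw [Complex.norm_real, Real.norm_eq_abs, sq_abs]
  have := mul_le_mul_of_nonneg_left (sum_antidiagonal_centralRatio_le n) Real.two_pi_pos.le
  refine this.trans_eq ?_
  ring

/-- Differentiation in θ multiplies each Fourier coefficient by a frequency of modulus at most n,
which costs a factor n² against the bound for P_n. -/
lemma integral_legendre_deriv_cos_sq_le (n : ℕ) :
    ∫ θ in (0 : ℝ)..2 * Real.pi,
      ((Polynomial.derivative (legendre n)).eval (Real.cos θ) * Real.sin θ) ^ 2 ≤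
      4 * Real.pi * n * (1 + Real.log (n + 1)) := by
  have h : ∀ θ : ℝ, ((Polynomial.derivative (legendre n)).eval (Real.cos θ) * Real.sin θ) ^ 2 =
      ‖(((Polynomial.derivative (legendre n)).eval (Real.cos θ) * Real.sin θ : ℝ) : ℂ)‖ ^ 2 :=
    fun θ => by rw [Complex.norm_real, Real.norm_eq_abs, sq_abs]
  simp_rw [h, legendre_deriv_cos]
  rw [integral_norm_sq_trigPoly _ _ (injOn_antidiagonal_sub n)]
  have hb : ∑ p ∈ Finset.HasAntidiagonal.antidiagonal n,
      ‖((centralRatio p.1 * centralRatio p.2 : ℝ) : ℂ) *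
        (-((((p.1 : ℤ) - (p.2 : ℤ) : ℤ) : ℂ) * Complex.I))‖ ^ 2 ≤
      ∑ p ∈ Finset.HasAntidiagonal.antidiagonal n,
        (n : ℝ) ^ 2 * (centralRatio p.1 * centralRatio p.2) ^ 2 := by
    refine Finset.sum_le_sum fun p hp => ?_
    have hp' : (p.1 : ℝ) + p.2 = n := by exact_mod_cast Finset.HasAntidiagonal.mem_antidiagonal.1 hp
    have h1 : (0 : ℝ) ≤ p.1 := by positivity
    have h2 : (0 : ℝ) ≤ p.2 := by positivity
    rw [norm_mul, norm_neg, norm_mul, Complex.norm_I, mul_one, mul_pow, Complex.norm_real,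
      Real.norm_eq_abs, sq_abs, Complex.norm_intCast, sq_abs, mul_comm]
    push_cast
    refine mul_le_mul_of_nonneg_right ?_ (sq_nonneg _)
    rw [← hp']
    nlinarith
  have hn : (n : ℝ) ^ 2 * (2 / ((n : ℝ) + 2)) ≤ 2 * n := by
    rw [mul_div_assoc', div_le_iff₀ (by positivity)]
    nlinarith [(Nat.cast_nonneg n : (0 : ℝ) ≤ n)]
  have hl : 0 ≤ 1 + Real.log ((n : ℝ) + 1) := by
    have := Real.log_nonneg (by linarith [(Nat.cast_nonneg n : (0 : ℝ) ≤ n)] : 1 ≤ (n : ℝ) + 1)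
    linarith
  have h3 := mul_le_mul_of_nonneg_left (sum_antidiagonal_centralRatio_le n) (sq_nonneg (n : ℝ))
  rw [← Finset.mul_sum] at hb
  calc _ ≤ 2 * Real.pi * (2 * n * (1 + Real.log (n + 1))) := by
        refine mul_le_mul_of_nonneg_left (hb.trans (h3.trans ?_)) Real.two_pi_pos.le
        rw [← mul_assoc]
        exact mul_le_mul_of_nonneg_right hn hl
    _ = _ := by ring

/-- The weight sin(θ/2) sin θ is at most 2 sin²(θ/2) = (sin²θ + (1 - cos θ)²)/2. The part with sin²θ
is absorbed by the derivatives, the part with (1 - cos θ)² by the Christoffel-Darboux identity,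
which trades (1 - t) times the kernel for (L+1)(P_L - P_{L+1}). -/
lemma zonal_cos_sq_le (L : ℕ) {θ : ℝ} (h0 : 0 ≤ θ) (hπ : θ ≤ Real.pi) :
    ((zonal L).eval (Real.cos θ)) ^ 2 * √((1 - Real.cos θ) / 2) * Real.sin θ ≤
      (((Polynomial.derivative (legendre L)).eval (Real.cos θ) * Real.sin θ) ^ 2 +
      ((Polynomial.derivative (legendre (L + 1))).eval (Real.cos θ) * Real.sin θ) ^ 2) +
      ((L : ℝ) + 1) ^ 2 * (((legendre L).eval (Real.cos θ)) ^ 2 +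
        ((legendre (L + 1)).eval (Real.cos θ)) ^ 2) := by
  have hs : 0 ≤ Real.sin (θ / 2) := Real.sin_nonneg_of_nonneg_of_le_pi (by linarith) (by linarith)
  have hc : 0 ≤ Real.cos (θ / 2) := Real.cos_nonneg_of_neg_pi_div_two_le_of_le
    (by linarith [Real.pi_pos]) (by linarith)
  have hsc := Real.sin_sq_add_cos_sq (θ / 2)
  have e1 : Real.cos θ = 1 - 2 * Real.sin (θ / 2) ^ 2 := by
    have := Real.cos_two_mul (θ / 2)
    rw [mul_div_cancel₀ _ (two_ne_zero)] at this
    linarith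
  have e2 : Real.sin θ = 2 * Real.sin (θ / 2) * Real.cos (θ / 2) := by
    have := Real.sin_two_mul (θ / 2)
    rwa [mul_div_cancel₀ _ (two_ne_zero)] at this
  have e3 : √((1 - Real.cos θ) / 2) = Real.sin (θ / 2) := by
    rw [e1, show (1 - (1 - 2 * Real.sin (θ / 2) ^ 2)) / 2 = Real.sin (θ / 2) ^ 2 by ring,
      Real.sqrt_sq hs]
  have hcd := congrArg (Polynomial.eval (Real.cos θ)) (one_sub_X_mul_derivative_legendre L)
  simp at hcd
  have hw : Real.sin (θ / 2) * Real.sin θ ≤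
      (Real.sin θ ^ 2 + (1 - Real.cos θ) ^ 2) / 2 := by
    have : Real.sin θ ^ 2 + (1 - Real.cos θ) ^ 2 = 4 * Real.sin (θ / 2) ^ 2 := by
      rw [e1, e2]
      linear_combination 4 * Real.sin (θ / 2) ^ 2 * hsc
    rw [this, e2]
    have hc1 : Real.cos (θ / 2) ≤ 1 := Real.cos_le_one _
    nlinarith [sq_nonneg (Real.sin (θ / 2))]
  rw [e3, mul_assoc]
  refine (mul_le_mul_of_nonneg_left hw (sq_nonneg _)).trans ?_
  have hz : (zonal L).eval (Real.cos θ) = (Polynomial.derivative (legendre L)).eval (Real.cos θ)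
      + (Polynomial.derivative (legendre (L + 1))).eval (Real.cos θ) := by simp [zonal]
  rw [← hz] at hcd
  have e4 : (zonal L).eval (Real.cos θ) ^ 2 * ((Real.sin θ ^ 2 + (1 - Real.cos θ) ^ 2) / 2) =
      (((zonal L).eval (Real.cos θ) * Real.sin θ) ^ 2 +
        ((1 - Real.cos θ) * (zonal L).eval (Real.cos θ)) ^ 2) / 2 := by ring
  rw [e4, hcd, hz]
  set x := (Polynomial.derivative (legendre L)).eval (Real.cos θ) * Real.sin θ
  set y := (Polynomial.derivative (legendre (L + 1))).eval (Real.cos θ) * Real.sin θ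
  set u := (legendre L).eval (Real.cos θ)
  set v := (legendre (L + 1)).eval (Real.cos θ)
  rw [add_mul, mul_pow]
  nlinarith [sq_nonneg (x - y), mul_nonneg (sq_nonneg ((L : ℝ) + 1)) (sq_nonneg (u + v))]

/-- The second moment of the kernel against the chordal distance. -/
lemma integral_zonal_sq_mul_sqrt_le (L : ℕ) :
    ∫ t in (-1 : ℝ)..1, ((zonal L).eval t) ^ 2 * √((1 - t) / 2) ≤
      16 * Real.pi * (L + 1) * (1 + Real.log (L + 2)) := by
  have hcv : ∫ t in (-1 : ℝ)..1, ((zonal L).eval t) ^ 2 * √((1 - t) / 2) =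
      ∫ θ in (0 : ℝ)..Real.pi,
        ((zonal L).eval (Real.cos θ)) ^ 2 * √((1 - Real.cos θ) / 2) * Real.sin θ := by
    have hg : Continuous fun t : ℝ => ((zonal L).eval t) ^ 2 * √((1 - t) / 2) := by fun_prop
    have := intervalIntegral.integral_comp_mul_deriv (a := 0) (b := Real.pi)
      (fun x _ => Real.hasDerivAt_cos x) (by fun_prop) hg
    rw [Real.cos_zero, Real.cos_pi] at this
    rw [intervalIntegral.integral_symm, ← this, ← intervalIntegral.integral_neg]
    simp
  set F : ℝ → ℝ := fun θ =>
    (((Polynomial.derivative (legendre L)).eval (Real.cos θ) * Real.sin θ) ^ 2 +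
      ((Polynomial.derivative (legendre (L + 1))).eval (Real.cos θ) * Real.sin θ) ^ 2) +
      ((L : ℝ) + 1) ^ 2 * (((legendre L).eval (Real.cos θ)) ^ 2 +
        ((legendre (L + 1)).eval (Real.cos θ)) ^ 2) with hF
  have hFc : Continuous F := by fun_prop
  have hF0 : ∀ θ, 0 ≤ F θ := fun θ => by positivity
  -- The majorant is nonnegative, so the range may be doubled to a full period, where Parseval
  -- applies.
  have h1 : ∫ θ in (0 : ℝ)..Real.pi,
        ((zonal L).eval (Real.cos θ)) ^ 2 * √((1 - Real.cos θ) / 2) * Real.sin θ ≤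
      ∫ θ in (0 : ℝ)..2 * Real.pi, F θ := by
    calc _ ≤ ∫ θ in (0 : ℝ)..Real.pi, F θ := by
          refine intervalIntegral.integral_mono_on Real.pi_pos.le ?_
            (hFc.intervalIntegrable _ _) fun θ hθ => zonal_cos_sq_le L hθ.1 hθ.2
          apply Continuous.intervalIntegrable
          fun_prop
      _ ≤ _ := by
          refine intervalIntegral.integral_mono_interval le_rfl Real.pi_pos.le
            (by linarith [Real.pi_pos]) (Filter.Eventually.of_forall hF0)
            (hFc.intervalIntegrable _ _)
  have h2 : ∫ θ in (0 : ℝ)..2 * Real.pi, F θ =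
      ((∫ θ in (0 : ℝ)..2 * Real.pi,
          ((Polynomial.derivative (legendre L)).eval (Real.cos θ) * Real.sin θ) ^ 2) +
        ∫ θ in (0 : ℝ)..2 * Real.pi,
          ((Polynomial.derivative (legendre (L + 1))).eval (Real.cos θ) * Real.sin θ) ^ 2) +
      ((L : ℝ) + 1) ^ 2 * ((∫ θ in (0 : ℝ)..2 * Real.pi, ((legendre L).eval (Real.cos θ)) ^ 2) +
        ∫ θ in (0 : ℝ)..2 * Real.pi, ((legendre (L + 1)).eval (Real.cos θ)) ^ 2) := by
    rw [hF, intervalIntegral.integral_add, intervalIntegral.integral_add,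
      intervalIntegral.integral_const_mul, intervalIntegral.integral_add]
    all_goals
      apply Continuous.intervalIntegrable
      fun_prop
  rw [hcv]
  refine h1.trans ?_
  rw [h2]
  have b1 := integral_legendre_deriv_cos_sq_le L
  have b2 := integral_legendre_deriv_cos_sq_le (L + 1)
  have b3 := integral_legendre_cos_sq_le L
  have b4 := integral_legendre_cos_sq_le (L + 1)
  have hL : (0 : ℝ) ≤ L := Nat.cast_nonneg L
  have hl : Real.log ((L : ℝ) + 1) ≤ Real.log (L + 2) :=
    Real.log_le_log (by linarith) (by linarith)
  have hl0 : 0 ≤ Real.log ((L : ℝ) + 1) := Real.log_nonneg (by linarith)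
  push_cast at b2 b4
  rw [show (L : ℝ) + 1 + 1 = L + 2 by ring] at b2 b4
  have hp := Real.pi_pos
  set H := 1 + Real.log ((L : ℝ) + 2) with hH
  have hHpos : 0 < H := by linarith
  -- Each of the four integrals, with its factor, is at most 4π(L+1)H, whence the constant 16π.
  have c1 : 4 * Real.pi * L * (1 + Real.log (L + 1)) ≤ 4 * Real.pi * (L + 1) * H := by
    gcongr <;> linarith
  have c3 : 4 * Real.pi / (L + 2) * (1 + Real.log (L + 1)) ≤ 4 * Real.pi / (L + 1) * H := by
    gcongr <;> linarith
  have c4 : 4 * Real.pi / (L + 1 + 2) * H ≤ 4 * Real.pi / (L + 1) * H := by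
    gcongr <;> linarith
  have c5 : ((L : ℝ) + 1) ^ 2 * (4 * Real.pi / (L + 1) * H) = 4 * Real.pi * (L + 1) * H := by
    field_simp
  have c6 := mul_le_mul_of_nonneg_left (b3.trans c3) (sq_nonneg ((L : ℝ) + 1))
  have c7 := mul_le_mul_of_nonneg_left (b4.trans c4) (sq_nonneg ((L : ℝ) + 1))
  rw [c5] at c6 c7
  rw [mul_add]
  linarith

end FourierBounds

/-! ### Invariance of the surface measure and Archimedes' theorem. -/

section SphereMeasure

open MeasureTheory Set
open scoped Pointwise

abbrev E3 : Type := EuclideanSpace ℝ (Fin 3)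

/-- The action of a linear isometry of `ℝ³` on the two-sphere. -/
noncomputable def sphereIsometry (R : E3 ≃ₗᵢ[ℝ] E3) (x : S2) : S2 :=
  ⟨R x, by rw [mem_sphere_zero_iff_norm, R.norm_map, mem_sphere_zero_iff_norm.1 x.2]⟩

@[simp] lemma coe_sphereIsometry (R : E3 ≃ₗᵢ[ℝ] E3) (x : S2) :
    (sphereIsometry R x : E3) = R x := rfl

lemma continuous_sphereIsometry (R : E3 ≃ₗᵢ[ℝ] E3) : Continuous (sphereIsometry R) :=
  (R.continuous.comp continuous_subtype_val).subtype_mk _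

instance : IsFiniteMeasure surfaceMeasure := by
  unfold surfaceMeasure; infer_instance

/-- The surface measure is invariant under linear isometries. -/
lemma measurePreserving_sphereIsometry (R : E3 ≃ₗᵢ[ℝ] E3) :
    MeasurePreserving (sphereIsometry R) surfaceMeasure surfaceMeasure := by
  refine ⟨(continuous_sphereIsometry R).measurable, ?_⟩
  ext s hs
  have hs' := (continuous_sphereIsometry R).measurable hs
  rw [Measure.map_apply (continuous_sphereIsometry R).measurable hs, surfaceMeasure,
    Measure.toSphere_apply' _ hs, Measure.toSphere_apply' _ hs']
  congr 1
  -- The surface measure of a set is a multiple of the volume of the cone over it, and isometries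
  -- map cones to cones.
  have h : Ioo (0 : ℝ) 1 • ((↑) '' (sphereIsometry R ⁻¹' s) : Set E3) =
      R ⁻¹' (Ioo (0 : ℝ) 1 • ((↑) '' s : Set E3)) := by
    ext v
    simp only [Set.mem_smul, mem_image, mem_preimage]
    constructor
    · rintro ⟨a, ha, _, ⟨x, hx, rfl⟩, rfl⟩
      exact ⟨a, ha, _, ⟨_, hx, rfl⟩, by simp⟩
    · rintro ⟨a, ha, _, ⟨x, hx, rfl⟩, hv⟩
      refine ⟨a, ha, _, ⟨sphereIsometry R.symm x, ?_, rfl⟩, ?_⟩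
      · convert hx
        ext1
        simp
      · rw [coe_sphereIsometry, ← map_smul, hv, R.symm_apply_apply]
  rw [h]
  exact R.measurePreserving.measure_preimage_equiv (f := R.toHomeomorph.toMeasurableEquiv) _

/-- The point `(1, 0, 0)` of the two-sphere. -/
noncomputable def northPole : S2 := ⟨EuclideanSpace.single 0 1, by simp⟩

lemma coe_northPole : (northPole : E3) = EuclideanSpace.single 0 1 := rfl

lemma inner_northPole (x : S2) : inner ℝ (x : E3) (northPole : E3) = (x : E3) 0 := by
  simp [coe_northPole, EuclideanSpace.inner_single_right]

/-- The reflection in the plane orthogonal to v - w. The fixed vectors matter: points of equal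
height can be exchanged while the pole stays in place. -/
lemma exists_isometry_of_norm_eq (v w : E3) (h : ‖v‖ = ‖w‖) :
    ∃ R : E3 ≃ₗᵢ[ℝ] E3, R v = w ∧ ∀ u : E3, inner ℝ (v - w) u = 0 → R u = u := by
  refine ⟨(Submodule.span ℝ {v - w})ᗮ.reflection, Submodule.reflection_sub h, fun u hu => ?_⟩
  rw [Submodule.reflection_eq_self_iff, Submodule.mem_orthogonal_singleton_iff_inner_right]
  exact hu

lemma norm_S2 (x : S2) : ‖(x : E3)‖ = 1 := mem_sphere_zero_iff_norm.1 x.2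

lemma integrable_gaussian_moment (n : ℕ) :
    Integrable fun t : ℝ => t ^ n * Real.exp (-t ^ 2) := by
  have := integrable_rpow_mul_exp_neg_mul_sq one_pos
    (s := n) (by linarith [(Nat.cast_nonneg n : (0 : ℝ) ≤ n)])
  simpa using this

lemma integral_Ioi_gaussian_moment (n : ℕ) :
    ∫ t in Ioi (0 : ℝ), t ^ n * Real.exp (-t ^ 2) = 1 / 2 * Real.Gamma (((n : ℝ) + 1) / 2) := by
  have := integral_rpow_mul_exp_neg_rpow (p := 2) (q := n) two_pos
    (by linarith [(Nat.cast_nonneg n : (0 : ℝ) ≤ n)])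
  simpa using this

lemma integral_gaussian_moment (n : ℕ) : ∫ t : ℝ, t ^ n * Real.exp (-t ^ 2) =
    (1 + (-1) ^ n) / 2 * Real.Gamma (((n : ℝ) + 1) / 2) := by
  have hi := integrable_gaussian_moment n
  rw [← integral_add_compl (measurableSet_Ioi (a := (0 : ℝ))) hi, compl_Ioi]
  have h2 : ∫ t in Iic (0 : ℝ), t ^ n * Real.exp (-t ^ 2) =
      (-1) ^ n * ∫ t in Ioi (0 : ℝ), t ^ n * Real.exp (-t ^ 2) := by
    have := integral_comp_neg_Iic 0 (fun t : ℝ => (-1) ^ n * (t ^ n * Real.exp (-t ^ 2)))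
    rw [neg_zero, integral_const_mul (μ := volume.restrict (Ioi 0))] at this
    rw [← this]
    congr 1
    ext t
    rw [neg_sq, ← mul_assoc, ← mul_pow]
    simp
  rw [h2, integral_Ioi_gaussian_moment]
  ring

lemma integral_E3_gaussian_moment (n : ℕ) : ∫ v : E3, v 0 ^ n * Real.exp (-‖v‖ ^ 2) =
    Real.pi * ((1 + (-1) ^ n) / 2 * Real.Gamma (((n : ℝ) + 1) / 2)) := by
  have h0 := integral_gaussian_moment 0
  rw [Nat.cast_zero, zero_add, Real.Gamma_one_half_eq] at h0
  norm_num at h0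
  rw [← (PiLp.volume_preserving_toLp (Fin 3)).integral_comp
    (MeasurableEquiv.toLp 2 _).measurableEmbedding]
  set f : Fin 3 → ℝ → ℝ := fun i t => (if i = 0 then t ^ n else 1) * Real.exp (-t ^ 2) with hf
  have : ∀ v : Fin 3 → ℝ, ((WithLp.toLp 2 v : E3) 0) ^ n * Real.exp (-‖(WithLp.toLp 2 v : E3)‖ ^ 2)
      = ∏ i, f i (v i) := fun v => by
    rw [EuclideanSpace.norm_sq_eq]
    simp [Fin.prod_univ_three, hf, Fin.sum_univ_three, Real.exp_add]
    ring
  simp_rw [this]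
  rw [integral_fintype_prod_volume_eq_prod]
  simp only [hf, Fin.prod_univ_three]
  simp [h0, integral_gaussian_moment]
  rw [mul_assoc, Real.mul_self_sqrt Real.pi_pos.le]
  ring

/-- Polar coordinates: v = t x gives v₀^n = t^n x₀^n, and the Jacobian t² accounts for the exponent
n + 2. Since the Gaussian integral also factors over coordinates, the spherical moments follow. -/
lemma integral_S2_mul_radial (n : ℕ) :
    (∫ x : S2, (x : E3) 0 ^ n ∂surfaceMeasure) *
      ∫ t in Ioi (0 : ℝ), t ^ (n + 2) * Real.exp (-t ^ 2) =
    ∫ v : E3, v 0 ^ n * Real.exp (-‖v‖ ^ 2) := by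
  have hdim : Module.finrank ℝ E3 - 1 = 2 := by simp
  have hr : ∫ t in Ioi (0 : ℝ), t ^ (n + 2) * Real.exp (-t ^ 2) =
      ∫ t : Ioi (0 : ℝ), (t : ℝ) ^ n * Real.exp (-(t : ℝ) ^ 2) ∂(.volumeIoiPow 2) := by
    simp only [Measure.volumeIoiPow, ENNReal.ofReal]
    rw [integral_withDensity_eq_integral_smul,
        integral_subtype_comap measurableSet_Ioi
          fun a : ℝ ↦ Real.toNNReal (a ^ 2) • (a ^ n * Real.exp (-a ^ 2)),
        setIntegral_congr_fun measurableSet_Ioi fun x hx ↦ ?_]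
    · rw [NNReal.smul_def, Real.coe_toNNReal _ (by positivity), smul_eq_mul, pow_add]
      ring
    · exact (measurable_subtype_coe.pow_const _).real_toNNReal
  have hvol : (Measure.volumeIoiPow 2) = .volumeIoiPow (Module.finrank ℝ E3 - 1) := by rw [hdim]
  rw [hr, surfaceMeasure, ← integral_prod_mul, hvol]
  symm
  calc ∫ v : E3, v 0 ^ n * Real.exp (-‖v‖ ^ 2) =
      ∫ v : ({(0 : E3)}ᶜ : Set E3), (v : E3) 0 ^ n * Real.exp (-‖(v : E3)‖ ^ 2)
        ∂(volume.comap Subtype.val) := by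
        rw [integral_subtype_comap (measurableSet_singleton _).compl
          fun v : E3 ↦ v 0 ^ n * Real.exp (-‖v‖ ^ 2), restrict_compl_singleton]
    _ = _ := by
        rw [← (volume : Measure E3).measurePreserving_homeomorphUnitSphereProd.integral_comp
          (Homeomorph.measurableEmbedding _)]
        congr 1
        ext v
        have hv : ‖(v : E3)‖ ≠ 0 := norm_ne_zero_iff.2 v.2
        simp
        rw [mul_pow, inv_pow]
        field_simp

lemma integral_S2_moment (n : ℕ) : ∫ x : S2, (x : E3) 0 ^ n ∂surfaceMeasure =
    2 * Real.pi * ∫ t in (-1 : ℝ)..1, t ^ n := by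
  have h := integral_S2_mul_radial n
  rw [integral_E3_gaussian_moment, integral_Ioi_gaussian_moment] at h
  have hn : (0 : ℝ) < ((n : ℝ) + 1) / 2 := by positivity
  have hg : Real.Gamma ((((n + 2 : ℕ) : ℝ) + 1) / 2) =
      ((n : ℝ) + 1) / 2 * Real.Gamma (((n : ℝ) + 1) / 2) := by
    rw [← Real.Gamma_add_one hn.ne']
    congr 1
    push_cast
    ring
  rw [hg] at h
  have hG := Real.Gamma_pos_of_pos hn
  rw [integral_pow]
  have h' : (∫ x : S2, (x : E3) 0 ^ n ∂surfaceMeasure) * ((n : ℝ) + 1) =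
      Real.pi * ((1 + (-1) ^ n) * 2) := by
    apply mul_right_cancel₀ hG.ne'
    linear_combination 4 * h
  field_simp
  rw [h', pow_succ]
  simp
  ring

lemma surfaceMeasure_real_univ : surfaceMeasure.real univ = 4 * Real.pi := by
  have := integral_S2_moment 0
  simp at this
  rw [this]
  ring

lemma integral_S2_polynomial (p : Polynomial ℝ) :
    ∫ x : S2, p.eval ((x : E3) 0) ∂surfaceMeasure =
      2 * Real.pi * ∫ t in (-1 : ℝ)..1, p.eval t := by
  simp_rw [Polynomial.eval_eq_sum_range]
  rw [integral_finsetSum, intervalIntegral.integral_finsetSum, Finset.mul_sum]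
  · refine Finset.sum_congr rfl fun n _ => ?_
    rw [integral_const_mul, intervalIntegral.integral_const_mul, integral_S2_moment]
    ring
  · intro n _
    apply Continuous.intervalIntegrable
    fun_prop
  · intro n _
    apply Continuous.integrable_of_hasCompactSupport
    · fun_prop
    · exact HasCompactSupport.of_compactSpace _

lemma integrable_S2 {F : Type*} [NormedAddCommGroup F] {f : S2 → F} (hf : Continuous f) :
    Integrable f surfaceMeasure :=
  hf.integrable_of_hasCompactSupport (HasCompactSupport.of_compactSpace _)

lemma coord_mem_Icc (x : S2) (i : Fin 3) : (x : E3) i ∈ Icc (-1 : ℝ) 1 := by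
  have := PiLp.norm_apply_le (x : E3) i
  rw [norm_S2 x, Real.norm_eq_abs] at this
  exact abs_le.1 this

/-- Archimedes' theorem: the projection of the surface measure to an axis is uniform. -/
lemma integral_S2_coord (f : ℝ → ℝ) (hf : Continuous f) :
    ∫ x : S2, f ((x : E3) 0) ∂surfaceMeasure = 2 * Real.pi * ∫ t in (-1 : ℝ)..1, f t := by
  rw [← sub_eq_zero, ← abs_nonpos_iff]
  refine le_of_forall_pos_le_add fun ε hε => ?_
  have hp := Real.pi_pos
  -- Weierstrass approximation reduces to polynomials. The total masses 4π on the sphere and 2π · 2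
  -- on the interval make each error ε/2.
  obtain ⟨p, hp'⟩ := exists_polynomial_near_of_continuousOn (-1) 1 f hf.continuousOn
    (ε / (8 * Real.pi)) (by positivity)
  have h1 : |(∫ x : S2, f ((x : E3) 0) ∂surfaceMeasure) -
      ∫ x : S2, p.eval ((x : E3) 0) ∂surfaceMeasure| ≤ ε / (8 * Real.pi) * (4 * Real.pi) := by
    rw [← integral_sub (integrable_S2 (by fun_prop)) (integrable_S2 (by fun_prop)),
      ← surfaceMeasure_real_univ]
    have hb : ∀ x : S2, ‖f ((x : E3) 0) - p.eval ((x : E3) 0)‖ ≤ ε / (8 * Real.pi) := fun x => by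
      rw [Real.norm_eq_abs, abs_sub_comm]
      exact (hp' _ (coord_mem_Icc x 0)).le
    exact norm_integral_le_of_norm_le_const (Filter.Eventually.of_forall hb)
  have h2 : |(∫ t in (-1 : ℝ)..1, p.eval t) - ∫ t in (-1 : ℝ)..1, f t| ≤
      ε / (8 * Real.pi) * 2 := by
    rw [← intervalIntegral.integral_sub (p.continuous.intervalIntegrable _ _)
      (hf.intervalIntegrable _ _)]
    have := intervalIntegral.norm_integral_le_of_norm_le_const (a := (-1 : ℝ)) (b := 1)
      (f := fun t => p.eval t - f t) (C := ε / (8 * Real.pi)) fun t ht => by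
        rw [uIoc_of_le (by norm_num)] at ht
        exact (hp' t ⟨ht.1.le, ht.2⟩).le
    rw [Real.norm_eq_abs] at this
    norm_num at this ⊢
    exact this
  have h3 := integral_S2_polynomial p
  rw [h3] at h1
  calc _ = |((∫ x : S2, f ((x : E3) 0) ∂surfaceMeasure) -
        2 * Real.pi * ∫ t in (-1 : ℝ)..1, p.eval t) +
        2 * Real.pi * ((∫ t in (-1 : ℝ)..1, p.eval t) - ∫ t in (-1 : ℝ)..1, f t)| := by
        congr 1; ring
    _ ≤ ε / (8 * Real.pi) * (4 * Real.pi) + 2 * Real.pi * (ε / (8 * Real.pi) * 2) := by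
        refine (abs_add_le _ _).trans (add_le_add h1 ?_)
        rw [abs_mul, abs_of_pos (by positivity : 0 < 2 * Real.pi)]
        gcongr
    _ = 0 + ε := by field_simp; ring

/-- The Funk-Hecke formula for constants. -/
lemma integral_S2_inner (f : ℝ → ℝ) (hf : Continuous f) (y : S2) :
    ∫ x : S2, f (inner ℝ (x : E3) (y : E3)) ∂surfaceMeasure =
      2 * Real.pi * ∫ t in (-1 : ℝ)..1, f t := by
  obtain ⟨R, hR, -⟩ := exists_isometry_of_norm_eq (northPole : E3) (y : E3)
    ((norm_S2 _).trans (norm_S2 _).symm)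
  have he : MeasurableEmbedding (sphereIsometry R) :=
    (continuous_sphereIsometry R).measurableEmbedding fun x x' h => by
      apply Subtype.ext
      exact R.injective (congrArg Subtype.val h)
  rw [← integral_S2_coord f hf, ← (measurePreserving_sphereIsometry R).integral_comp he]
  refine integral_congr_ae (Filter.Eventually.of_forall fun x => ?_)
  simp only [coe_sphereIsometry]
  rw [← hR, R.inner_map_map, inner_northPole]

end SphereMeasure

/-! ### Fischer decomposition and the space of polynomials on the sphere. -/

section Harmonics

open MvPolynomial

/-- The squared norm, as a polynomial in three variables. -/
noncomputable def sqNormPoly : MvPolynomial (Fin 3) ℂ := ∑ i, X i ^ 2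

lemma laplacian_apply (p : MvPolynomial (Fin 3) ℂ) :
    laplacian p = ∑ i : Fin 3, pderiv i (pderiv i p) := by
  simp [laplacian]

lemma isHomogeneous_sqNormPoly : sqNormPoly.IsHomogeneous 2 :=
  IsHomogeneous.sum _ _ _ fun i _ => isHomogeneous_X_pow i 2

lemma isHomogeneous_laplacian {p : MvPolynomial (Fin 3) ℂ} {n : ℕ} (hp : p.IsHomogeneous n) :
    (laplacian p).IsHomogeneous (n - 2) := by
  rw [laplacian_apply]
  refine IsHomogeneous.sum _ _ _ fun i _ => ?_
  have := (hp.pderiv (i := i)).pderiv (i := i)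
  rwa [Nat.sub_sub] at this

lemma pderiv_sqNormPoly (i : Fin 3) : pderiv i sqNormPoly = 2 * X i := by
  unfold sqNormPoly
  rw [map_sum, Finset.sum_eq_single i]
  · simp
  · intro j _ hji
    simp [pderiv_X_of_ne hji]
  · simp

/-- Leibniz: the Laplacian of |x|² is 6, and the cross term 4 Σ x_i ∂_i p is 4np by Euler's
identity. -/
lemma laplacian_sqNormPoly_mul {p : MvPolynomial (Fin 3) ℂ} {n : ℕ} (hp : p.IsHomogeneous n) :
    laplacian (sqNormPoly * p) = ((6 + 4 * n : ℕ) : ℂ) • p + sqNormPoly * laplacian p := by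
  have he := hp.sum_X_mul_pderiv
  rw [laplacian_apply, laplacian_apply]
  have : ∀ i : Fin 3, pderiv i (pderiv i (sqNormPoly * p)) =
      2 * p + 4 * (X i * pderiv i p) + sqNormPoly * pderiv i (pderiv i p) := fun i => by
    have h2 : pderiv i (2 : MvPolynomial (Fin 3) ℂ) = 0 := by
      rw [show (2 : MvPolynomial (Fin 3) ℂ) = C 2 from (map_ofNat C 2).symm, pderiv_C]
    simp only [Derivation.leibniz, map_add, pderiv_sqNormPoly, smul_eq_mul, pderiv_X_self, h2]
    ring
  simp_rw [this]
  rw [Finset.sum_add_distrib, Finset.sum_add_distrib, ← Finset.mul_sum, ← Finset.mul_sum, he,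
    smul_eq_C_mul, ← Finset.mul_sum]
  simp [show (C 4 : MvPolynomial (Fin 3) ℂ) = 4 from map_ofNat C 4,
    show (C 6 : MvPolynomial (Fin 3) ℂ) = 6 from map_ofNat C 6]
  ring

lemma laplacian_sqNormPoly_pow_mul {h : MvPolynomial (Fin 3) ℂ} {n : ℕ} (hh : h.IsHomogeneous n)
    (hΔ : laplacian h = 0) (j : ℕ) : ∃ c : ℕ, c ≠ 0 ∧
      laplacian (sqNormPoly ^ (j + 1) * h) = (c : ℂ) • (sqNormPoly ^ j * h) := by
  induction j with
  | zero =>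
    refine ⟨6 + 4 * n, by omega, ?_⟩
    rw [zero_add, pow_one, laplacian_sqNormPoly_mul hh, hΔ, mul_zero, add_zero, pow_zero, one_mul]
  | succ j ih =>
    obtain ⟨c, hc, e⟩ := ih
    refine ⟨6 + 4 * (2 * (j + 1) + n) + c, by omega, ?_⟩
    rw [pow_succ', mul_assoc,
      laplacian_sqNormPoly_mul ((isHomogeneous_sqNormPoly.pow (j + 1)).mul hh), e,
      mul_smul_comm, ← mul_assoc, ← pow_succ', ← add_smul]
    push_cast
    rfl

/-- The span of the products of powers of the squared norm and harmonic polynomials, of total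
degree `n`. -/
noncomputable def fischerSpan (n : ℕ) : Submodule ℂ (MvPolynomial (Fin 3) ℂ) :=
  Submodule.span ℂ {p | ∃ (j m : ℕ) (h : MvPolynomial (Fin 3) ℂ), m + 2 * j = n ∧
    h.IsHomogeneous m ∧ laplacian h = 0 ∧ p = sqNormPoly ^ j * h}

lemma fischerSpan_le (n : ℕ) : fischerSpan n ≤ homogeneousSubmodule (Fin 3) ℂ n := by
  refine Submodule.span_le.2 ?_
  rintro _ ⟨j, m, h, hn, hh, -, rfl⟩
  have := (isHomogeneous_sqNormPoly.pow j).mul hh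
  rw [show 2 * j + m = n by omega] at this
  exact this

/-- The Fischer decomposition of homogeneous polynomials. -/
lemma mem_fischerSpan (n : ℕ) (p : MvPolynomial (Fin 3) ℂ) (hp : p.IsHomogeneous n) :
    p ∈ fischerSpan n := by
  induction n using Nat.strong_induction_on generalizing p with
  | _ n ih =>
    have hharm : ∀ q : MvPolynomial (Fin 3) ℂ, q.IsHomogeneous n → laplacian q = 0 →
        q ∈ fischerSpan n := fun q hq hΔ =>
      Submodule.subset_span ⟨0, n, q, by omega, hq, hΔ, by simp⟩
    by_cases hn : n < 2
    · refine hharm p hp ?_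
      rw [laplacian_apply]
      refine Finset.sum_eq_zero fun i _ => ?_
      have h1 := hp.pderiv (i := i)
      rw [show n - 1 = 0 by omega] at h1
      rw [← totalDegree_zero_iff_isHomogeneous, totalDegree_eq_zero_iff_eq_C] at h1
      rw [h1, pderiv_C]
    -- The Laplacian maps the span in degree n onto the span in degree n - 2, because it lowers the
    -- power of |x|² by one up to a nonzero factor. By induction the Laplacian of p lies in the
    -- latter, so p differs from a member of the span by a harmonic polynomial.
    · have hsol : ∀ g ∈ fischerSpan (n - 2), ∃ q ∈ fischerSpan n, laplacian q = g := by
        intro g hg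
        refine Submodule.span_induction ?_ ⟨0, Submodule.zero_mem _, map_zero _⟩ ?_ ?_ hg
        · rintro _ ⟨j, m, h, hm, hh, hΔ, rfl⟩
          obtain ⟨c, hc, e⟩ := laplacian_sqNormPoly_pow_mul hh hΔ j
          refine ⟨(c : ℂ)⁻¹ • (sqNormPoly ^ (j + 1) * h), Submodule.smul_mem _ _
            (Submodule.subset_span ⟨j + 1, m, h, by omega, hh, hΔ, rfl⟩), ?_⟩
          rw [map_smul, e, inv_smul_smul₀ (by exact_mod_cast hc)]
        · rintro _ _ _ _ ⟨q, hq, rfl⟩ ⟨q', hq', rfl⟩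
          exact ⟨q + q', Submodule.add_mem _ hq hq', map_add _ _ _⟩
        · rintro a _ _ ⟨q, hq, rfl⟩
          exact ⟨a • q, Submodule.smul_mem _ _ hq, map_smul _ _ _⟩
      obtain ⟨q, hq, e⟩ := hsol _ (ih (n - 2) (by omega) _ (isHomogeneous_laplacian hp))
      have hd := hharm (p - q) (hp.sub (fischerSpan_le n hq)) (by rw [map_sub, e, sub_self])
      simpa using Submodule.add_mem _ hd hq

lemma restrictToSphere_apply (F : MvPolynomial (Fin 3) ℂ) (x : S2) :
    restrictToSphere F x = eval (fun i => (((x : E3) i : ℝ) : ℂ)) F := rfl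

lemma restrictToSphere_sqNormPoly_pow_mul (j : ℕ) (h : MvPolynomial (Fin 3) ℂ) :
    restrictToSphere (sqNormPoly ^ j * h) = restrictToSphere h := by
  ext x
  have hx := sum_sq_S2 x
  have : eval (fun i => (((x : E3) i : ℝ) : ℂ)) sqNormPoly = 1 := by
    simp only [sqNormPoly, Fin.sum_univ_three, map_add, map_pow, eval_X]
    have := congrArg Complex.ofReal hx
    push_cast at this
    exact this
  rw [restrictToSphere_apply, restrictToSphere_apply, map_mul, map_pow, this, one_pow, one_mul]

lemma sphericalHarmonics_le_harmonicSpace {l L : ℕ} (h : l ≤ L) :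
    sphericalHarmonics l ≤ harmonicSpace L :=
  le_biSup sphericalHarmonics (Finset.mem_range.2 (Nat.lt_succ_of_le h))

/-- `harmonicSpace L` consists of the restrictions of all polynomials of degree at most `L`. -/
lemma mem_harmonicSpace_iff (L : ℕ) (f : S2 → ℂ) : f ∈ harmonicSpace L ↔
    ∃ F : MvPolynomial (Fin 3) ℂ, F.totalDegree ≤ L ∧ restrictToSphere F = f := by
  constructor
  · intro hf
    have hle : harmonicSpace L ≤ (restrictTotalDegree (Fin 3) ℂ L).map restrictToSphere := by
      refine iSup₂_le fun l hl => ?_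
      refine Submodule.map_mono fun p hp => ?_
      rw [mem_restrictTotalDegree]
      exact (IsHomogeneous.totalDegree_le hp.1).trans (Nat.lt_succ_iff.1 (Finset.mem_range.1 hl))
    obtain ⟨F, hF, e⟩ := hle hf
    exact ⟨F, (mem_restrictTotalDegree _ _ _).1 hF, e⟩
  · rintro ⟨F, hF, rfl⟩
    rw [← sum_homogeneousComponent F, map_sum]
    refine Submodule.sum_mem _ fun n hn => ?_
    have hmem := mem_fischerSpan n _ (homogeneousComponent_isHomogeneous n F)
    have hle : fischerSpan n ≤ (harmonicSpace L).comap restrictToSphere := by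
      refine Submodule.span_le.2 ?_
      rintro _ ⟨j, m, h, hm, hh, hΔ, rfl⟩
      rw [SetLike.mem_coe, Submodule.mem_comap, restrictToSphere_sqNormPoly_pow_mul]
      have := Finset.mem_range.1 hn
      exact sphericalHarmonics_le_harmonicSpace (by omega : m ≤ L) ⟨h, ⟨hh, hΔ⟩, rfl⟩
    exact hle hmem

lemma totalDegree_aeval_le {σ τ : Type*} [Fintype σ] (g : σ → MvPolynomial τ ℂ)
    (hg : ∀ i, (g i).totalDegree ≤ 1) (F : MvPolynomial σ ℂ) :
    (aeval g F).totalDegree ≤ F.totalDegree := by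
  rw [aeval_def, eval₂_eq']
  refine (totalDegree_finsetSum _ _).trans (Finset.sup_le fun d hd => ?_)
  refine (totalDegree_mul _ _).trans ?_
  rw [algebraMap_eq, totalDegree_C, zero_add]
  refine (totalDegree_finsetProd _ _).trans ?_
  have hd' := le_totalDegree hd
  rw [Finsupp.sum_fintype _ _ (by simp)] at hd'
  refine le_trans (Finset.sum_le_sum fun i _ => ?_) hd'
  exact (totalDegree_pow _ _).trans (by have := hg i; nlinarith)

/-- The linear form `x ↦ ⟨x, y⟩` as a polynomial. -/
noncomputable def linearForm (y : E3) : MvPolynomial (Fin 3) ℂ := ∑ i, C ((y i : ℝ) : ℂ) * X i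

lemma totalDegree_linearForm_le (y : E3) : (linearForm y).totalDegree ≤ 1 := by
  refine (totalDegree_finsetSum _ _).trans (Finset.sup_le fun i _ => ?_)
  refine (totalDegree_mul _ _).trans ?_
  simp

lemma eval_linearForm (x y : E3) :
    eval (fun i => ((x i : ℝ) : ℂ)) (linearForm y) = ((inner ℝ x y : ℝ) : ℂ) := by
  simp [linearForm, PiLp.inner_apply, Fin.sum_univ_three]

/-- A linear substitution does not raise the degree, so invariance is immediate once the space is
described by all polynomials of degree at most L. -/
lemma comp_sphereIsometry_mem {L : ℕ} {f : S2 → ℂ} (hf : f ∈ harmonicSpace L)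
    (R : E3 ≃ₗᵢ[ℝ] E3) : f ∘ sphereIsometry R ∈ harmonicSpace L := by
  rw [mem_harmonicSpace_iff] at hf ⊢
  obtain ⟨F, hF, rfl⟩ := hf
  refine ⟨aeval (fun i => linearForm (R.symm (EuclideanSpace.single i 1))) F,
    (totalDegree_aeval_le _ (fun i => totalDegree_linearForm_le _) F).trans hF, ?_⟩
  ext x
  rw [restrictToSphere_apply, Function.comp_apply, restrictToSphere_apply, ← aeval_eq_eval,
    ← aeval_eq_eval]
  rw [← AlgHom.comp_apply, comp_aeval]
  congr 2
  ext i
  rw [aeval_eq_eval, eval_linearForm, ← R.inner_map_map, R.apply_symm_apply]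
  simp [EuclideanSpace.inner_single_right]

lemma zonal_mem_harmonicSpace {L : ℕ} (q : Polynomial ℂ) (hq : q.natDegree ≤ L) (y : S2) :
    (fun x : S2 => q.eval ((inner ℝ (x : E3) (y : E3) : ℝ) : ℂ)) ∈ harmonicSpace L := by
  rw [mem_harmonicSpace_iff]
  refine ⟨∑ n ∈ Finset.range (q.natDegree + 1), C (q.coeff n) * linearForm y ^ n, ?_, ?_⟩
  · refine (totalDegree_finsetSum _ _).trans (Finset.sup_le fun n hn => ?_)
    refine (totalDegree_mul _ _).trans ?_
    rw [totalDegree_C, zero_add]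
    refine (totalDegree_pow _ _).trans ?_
    have := totalDegree_linearForm_le y
    have := Finset.mem_range.1 hn
    nlinarith
  · ext x
    rw [restrictToSphere_apply, map_sum, Polynomial.eval_eq_sum_range]
    refine Finset.sum_congr rfl fun n _ => ?_
    rw [map_mul, eval_C, map_pow, eval_linearForm]

end Harmonics

/-! ### Identification of the reproducing kernel. -/

section Kernel

open MeasureTheory Set

/-- Reproducing K(·, y) with K' and K'(·, x) with K shows that K(x, y) is the conjugate of K'(y, x).
The case K' = K gives Hermitian symmetry, and the two combine. -/
lemma IsReproducingKernel.unique {Λ : Type*} [MeasurableSpace Λ] {μ : Measure Λ}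
    {H : Submodule ℂ (Λ → ℂ)} {K K' : Λ → Λ → ℂ} (hK : IsReproducingKernel μ H K)
    (hK' : IsReproducingKernel μ H K') (x y : Λ) : K x y = K' x y := by
  have h (K K' : Λ → Λ → ℂ) (hK : IsReproducingKernel μ H K)
      (hK' : IsReproducingKernel μ H K') (x y : Λ) : K x y = (starRingEnd ℂ) (K' y x) := by
    rw [hK'.reproducing _ (hK.mem y) x, hK.reproducing _ (hK'.mem x) y, ← integral_conj]
    congr 1
    ext z
    rw [map_mul, Complex.conj_conj, mul_comm]
  rw [h K K hK hK, h K' K hK' hK]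

lemma measurableEmbedding_sphereIsometry (R : E3 ≃ₗᵢ[ℝ] E3) :
    MeasurableEmbedding (sphereIsometry R) :=
  (continuous_sphereIsometry R).measurableEmbedding fun _ _ h =>
    Subtype.ext (R.injective (congrArg Subtype.val h))

/-- The kernel composed with an isometry reproduces the same space, since both the space and the
measure are invariant; uniqueness concludes. -/
lemma kernel_sphereIsometry {L : ℕ} {K : S2 → S2 → ℂ}
    (hK : IsReproducingKernel surfaceMeasure (harmonicSpace L) K) (R : E3 ≃ₗᵢ[ℝ] E3) (x y : S2) :
    K (sphereIsometry R x) (sphereIsometry R y) = K x y := by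
  refine IsReproducingKernel.unique
    (K := fun x y => K (sphereIsometry R x) (sphereIsometry R y)) ⟨fun x => ?_, fun f hf x => ?_⟩
    hK x y
  · exact comp_sphereIsometry_mem (hK.mem (sphereIsometry R x)) R
  · have hinv : ∀ x : S2, sphereIsometry R.symm (sphereIsometry R x) = x := fun x =>
      Subtype.ext (R.symm_apply_apply _)
    have h := hK.reproducing _ (comp_sphereIsometry_mem hf R.symm) (sphereIsometry R x)
    rw [Function.comp_apply, hinv,
      ← (measurePreserving_sphereIsometry R).integral_comp (measurableEmbedding_sphereIsometry R)]
      at h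
    simpa only [Function.comp_apply, hinv] using h

lemma kernel_northPole_eq {L : ℕ} {K : S2 → S2 → ℂ}
    (hK : IsReproducingKernel surfaceMeasure (harmonicSpace L) K) (x x' : S2)
    (h : (x : E3) 0 = (x' : E3) 0) : K x northPole = K x' northPole := by
  obtain ⟨R, hR, hfix⟩ := exists_isometry_of_norm_eq (x : E3) (x' : E3)
    ((norm_S2 _).trans (norm_S2 _).symm)
  have he : R northPole = northPole := hfix _ (by
    rw [inner_sub_left, inner_northPole, inner_northPole, h, sub_self])
  rw [← kernel_sphereIsometry hK R, show sphereIsometry R x = x' from Subtype.ext hR,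
    show sphereIsometry R northPole = northPole from Subtype.ext he]

open MvPolynomial in
/-- Symmetrizing a polynomial over the two points `(t, ±s, 0)` of the unit circle gives a
polynomial in `t`. -/
lemma exists_even_part (F : MvPolynomial (Fin 3) ℂ) : ∃ u v : Polynomial ℝ,
    u.natDegree ≤ F.totalDegree ∧ v.natDegree ≤ F.totalDegree ∧
    ∀ t s : ℝ, s ^ 2 = 1 - t ^ 2 →
      eval ![(t : ℂ), (s : ℂ), 0] F + eval ![(t : ℂ), -(s : ℂ), 0] F =
        2 * ((u.eval t : ℝ) + (v.eval t : ℝ) * Complex.I) := by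
  -- Odd powers of s cancel between ±s, and even ones become powers of 1 - t². The factor 0 ^ d 2,
  -- with 0 ^ 0 = 1, keeps only monomials without the third variable.
  set w : (Fin 3 →₀ ℕ) → Polynomial ℝ := fun d =>
    Polynomial.C (if Even (d 1) then 0 ^ d 2 else 0) *
      (Polynomial.X ^ d 0 * (1 - Polynomial.X ^ 2) ^ (d 1 / 2)) with hw
  have hdeg : ∀ d ∈ F.support, (w d).natDegree ≤ F.totalDegree := fun d hd => by
    have hd' := le_totalDegree hd
    rw [Finsupp.sum_fintype _ _ (by simp), Fin.sum_univ_three] at hd'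
    refine (Polynomial.natDegree_C_mul_le _ _).trans ?_
    refine Polynomial.natDegree_mul_le.trans ?_
    rw [Polynomial.natDegree_X_pow]
    have h1 : ((1 - Polynomial.X ^ 2 : Polynomial ℝ)).natDegree ≤ 2 := by
      refine (Polynomial.natDegree_sub_le _ _).trans ?_
      simp
    have h2 : ((1 - Polynomial.X ^ 2 : Polynomial ℝ) ^ (d 1 / 2)).natDegree ≤ d 1 / 2 * 2 :=
      Polynomial.natDegree_pow_le.trans (Nat.mul_le_mul_left _ h1)
    omega
  have heval : ∀ (d : Fin 3 →₀ ℕ) (t s : ℝ), s ^ 2 = 1 - t ^ 2 →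
      (∏ i, (![(t : ℂ), (s : ℂ), 0] : Fin 3 → ℂ) i ^ d i) +
        (∏ i, (![(t : ℂ), -(s : ℂ), 0] : Fin 3 → ℂ) i ^ d i) = 2 * (((w d).eval t : ℝ) : ℂ) := by
    intro d t s hs
    simp only [Fin.prod_univ_three, hw]
    simp only [Matrix.cons_val_zero, Matrix.cons_val_one, Matrix.cons_val, Polynomial.eval_mul,
      Polynomial.eval_C, Polynomial.eval_pow, Polynomial.eval_X, Polynomial.eval_sub,
      Polynomial.eval_one]
    rcases Nat.even_or_odd (d 1) with h | h
    · rw [if_pos h, ← hs, ← pow_mul, Nat.mul_div_cancel' h.two_dvd, h.neg_pow]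
      push_cast
      ring
    · rw [if_neg (Nat.not_even_iff_odd.2 h), h.neg_pow]
      push_cast
      ring
  clear_value w
  refine ⟨∑ d ∈ F.support, Polynomial.C (F.coeff d).re * w d,
    ∑ d ∈ F.support, Polynomial.C (F.coeff d).im * w d, ?_, ?_, fun t s hs => ?_⟩
  · exact Polynomial.natDegree_sum_le_of_forall_le _ _ fun d hd =>
      (Polynomial.natDegree_C_mul_le _ _).trans (hdeg d hd)
  · exact Polynomial.natDegree_sum_le_of_forall_le _ _ fun d hd =>
      (Polynomial.natDegree_C_mul_le _ _).trans (hdeg d hd)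
  · rw [eval_eq', eval_eq', ← Finset.sum_add_distrib, Polynomial.eval_finsetSum,
      Polynomial.eval_finsetSum, Complex.ofReal_sum, Complex.ofReal_sum, Finset.sum_mul,
      ← Finset.sum_add_distrib, Finset.mul_sum]
    refine Finset.sum_congr rfl fun d _ => ?_
    rw [← mul_add, heval d t s hs, Polynomial.eval_mul, Polynomial.eval_C, Polynomial.eval_mul,
      Polynomial.eval_C, Complex.ofReal_mul, Complex.ofReal_mul]
    conv_lhs => rw [← Complex.re_add_im (coeff d F)]
    ring

/-- K(·, pole) depends only on the height t, so it may be evaluated at both (t, ±s, 0) and averaged.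
Real and imaginary parts are separated because the orthogonality relations are over ℝ. -/
lemma exists_polynomial_kernel_northPole {L : ℕ} {K : S2 → S2 → ℂ}
    (hK : IsReproducingKernel surfaceMeasure (harmonicSpace L) K) :
    ∃ u v : Polynomial ℝ, u.natDegree ≤ L ∧ v.natDegree ≤ L ∧ ∀ x : S2, K x northPole =
      ((u.eval ((x : E3) 0) : ℝ) : ℂ) + ((v.eval ((x : E3) 0) : ℝ) : ℂ) * Complex.I := by
  obtain ⟨F, hF, e⟩ := (mem_harmonicSpace_iff L _).1 (hK.mem northPole)
  obtain ⟨u, v, hu, hv, huv⟩ := exists_even_part F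
  refine ⟨u, v, hu.trans hF, hv.trans hF, fun x => ?_⟩
  set t := (x : E3) 0 with ht
  have ht1 : 0 ≤ 1 - t ^ 2 := by
    have := sum_sq_S2 x
    rw [← ht] at this
    nlinarith [sq_nonneg ((x : E3) 1), sq_nonneg ((x : E3) 2)]
  have hs : √(1 - t ^ 2) ^ 2 = 1 - t ^ 2 := Real.sq_sqrt ht1
  have hmem : ∀ s : ℝ, s ^ 2 = 1 - t ^ 2 → ∃ y : S2, (y : E3) = !₂[t, s, 0] := fun s hs =>
    ⟨⟨!₂[t, s, 0], by
      rw [mem_sphere_zero_iff_norm, EuclideanSpace.norm_eq, Real.sqrt_eq_one]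
      simp [Fin.sum_univ_three, hs]⟩, rfl⟩
  have hval : ∀ s : ℝ, s ^ 2 = 1 - t ^ 2 →
      K x northPole = MvPolynomial.eval ![(t : ℂ), (s : ℂ), 0] F := fun s hs => by
    obtain ⟨y, hy⟩ := hmem s hs
    rw [kernel_northPole_eq hK x y (by rw [hy]; simp [ht])]
    have := congrFun e y
    rw [← this, restrictToSphere_apply, hy]
    congr 2
    ext i
    fin_cases i <;> simp
  have h1 := hval _ hs
  have h2 := hval (-√(1 - t ^ 2)) (by rw [neg_sq, hs])
  have h3 := huv t _ hs
  rw [Complex.ofReal_neg] at h2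
  rw [← h1, ← h2] at h3
  linear_combination h3 / 2

lemma eval_eq_zero_of_integralPoly_sq {p : Polynomial ℝ} (h : integralPoly (p * p) = 0) {t : ℝ}
    (ht : t ∈ Icc (-1 : ℝ) 1) : p.eval t = 0 := by
  by_contra hne
  have := intervalIntegral.integral_pos (f := fun t => (p * p).eval t) (a := -1) (b := 1)
    (by norm_num) (p * p).continuousOn
    (fun x _ => by rw [Polynomial.eval_mul]; exact mul_self_nonneg _)
    ⟨t, ht, by rw [Polynomial.eval_mul]; exact mul_self_pos.2 hne⟩
  rw [integralPoly_apply] at h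
  linarith

/-- The reproducing kernel of the spherical harmonics of degree at most `L`. -/
lemma kernel_eq_zonal {L : ℕ} {K : S2 → S2 → ℂ}
    (hK : IsReproducingKernel surfaceMeasure (harmonicSpace L) K) (x y : S2) :
    K x y = (((zonal L).eval (inner ℝ (x : E3) (y : E3)) / (4 * Real.pi) : ℝ) : ℂ) := by
  have hpi := Real.pi_pos
  have hpole : ∀ x : S2, K x northPole =
      (((zonal L).eval ((x : E3) 0) / (4 * Real.pi) : ℝ) : ℂ) := by
    obtain ⟨u, v, hu, hv, huv⟩ := exists_polynomial_kernel_northPole hK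
    -- The reproducing property at the pole, tested on zonal polynomials and reduced to an interval
    -- by Archimedes.
    have hrep : ∀ q : Polynomial ℝ, q.natDegree ≤ L →
        2 * Real.pi * integralPoly (q * u) = q.eval 1 ∧ 2 * Real.pi * integralPoly (q * v) = 0 := by
      intro q hq
      have hmem := zonal_mem_harmonicSpace (L := L) (q.map (algebraMap ℝ ℂ))
        (Polynomial.natDegree_map_le.trans hq) northPole
      have h := hK.reproducing _ hmem northPole
      have hev : ∀ t : ℝ, (q.map (algebraMap ℝ ℂ)).eval (t : ℂ) = ((q.eval t : ℝ) : ℂ) :=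
        fun t => by
          rw [Polynomial.eval_map_algebraMap]
          exact Polynomial.aeval_algebraMap_apply_eq_algebraMap_eval t q
      simp only [hev, huv, inner_northPole] at h
      have h1 : ((northPole : S2) : E3) 0 = 1 := by simp [coe_northPole]
      rw [h1] at h
      have hsplit : ∀ x : S2, ((q.eval ((x : E3) 0) : ℝ) : ℂ) *
          (starRingEnd ℂ) (((u.eval ((x : E3) 0) : ℝ) : ℂ) +
            ((v.eval ((x : E3) 0) : ℝ) : ℂ) * Complex.I) =
          (((q * u).eval ((x : E3) 0) : ℝ) : ℂ) -
            (((q * v).eval ((x : E3) 0) : ℝ) : ℂ) * Complex.I := fun x => by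
        simp [Polynomial.eval_mul]
        ring
      simp_rw [hsplit] at h
      rw [integral_sub (integrable_S2 (by fun_prop)) (integrable_S2 (by fun_prop)),
        integral_mul_const, integral_complex_ofReal, integral_complex_ofReal,
        integral_S2_polynomial, integral_S2_polynomial] at h
      have hre := congrArg Complex.re h
      have him := congrArg Complex.im h
      rw [Complex.sub_re, Complex.mul_I_re, Complex.ofReal_im, neg_zero, sub_zero, Complex.ofReal_re,
        Complex.ofReal_re] at hre
      rw [Complex.sub_im, Complex.ofReal_im, Complex.ofReal_im, Complex.mul_I_im,
        Complex.ofReal_re, zero_sub, eq_comm, neg_eq_zero] at him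
      exact ⟨hre.symm, him⟩
    have hv0 : ∀ t ∈ Icc (-1 : ℝ) 1, v.eval t = 0 := fun t ht =>
      eval_eq_zero_of_integralPoly_sq
        ((mul_eq_zero.1 (hrep v hv).2).resolve_left (by positivity)) ht
    set z : Polynomial ℝ := Polynomial.C (1 / (4 * Real.pi)) * zonal L with hz
    have hzdeg : (u - z).natDegree ≤ L := (Polynomial.natDegree_sub_le _ _).trans
      (max_le hu ((Polynomial.natDegree_C_mul_le _ _).trans (natDegree_zonal_le L)))
    -- Both u and z represent evaluation at 1 on degree at most L, so u - z is orthogonal to itself.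
    have hu0 : ∀ t ∈ Icc (-1 : ℝ) 1, (u - z).eval t = 0 := fun t ht => by
      refine eval_eq_zero_of_integralPoly_sq ?_ ht
      have h1 := (hrep _ hzdeg).1
      have h2 := integralPoly_zonal_mul L _ hzdeg
      have h3 : integralPoly ((u - z) * z) = 1 / (4 * Real.pi) * (2 * (u - z).eval 1) := by
        have e : (u - z) * z = (1 / (4 * Real.pi)) • (zonal L * (u - z)) := by
          rw [Polynomial.smul_eq_C_mul, hz]
          ring
        rw [e, map_smul, smul_eq_mul, h2]
      rw [mul_sub, map_sub, h3, ← h1]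
      field_simp
      ring
    intro x
    have hx := coord_mem_Icc x 0
    have h1 := hu0 _ hx
    rw [Polynomial.eval_sub, sub_eq_zero] at h1
    rw [huv, hv0 _ hx, h1, hz, Polynomial.eval_mul, Polynomial.eval_C, Complex.ofReal_zero,
      zero_mul, add_zero]
    congr 1
    ring
  obtain ⟨R, hR, -⟩ := exists_isometry_of_norm_eq (y : E3) (northPole : E3)
    ((norm_S2 _).trans (norm_S2 _).symm)
  rw [← kernel_sphereIsometry hK R, show sphereIsometry R y = northPole from Subtype.ext hR, hpole,
    ← inner_northPole, ← hR, coe_sphereIsometry, R.inner_map_map]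

end Kernel

/-! ### From moments of disjoint sets to the second factorial moment measure. -/

section PointProcess

open MeasureTheory Set
open scoped ENNReal

/-- The second factorial moment measure of the process with law `P`. -/
noncomputable def pairMeasure {Λ : Type*} [MeasurableSpace Λ] {n : ℕ}
    (P : Measure (Fin n → Λ)) : Measure (Λ × Λ) :=
  ∑ p ∈ (Finset.univ : Finset (Fin n)).offDiag, P.map fun x => (x p.1, x p.2)

lemma measurable_pair {Λ : Type*} [MeasurableSpace Λ] {n : ℕ} (p : Fin n × Fin n) :
    Measurable fun x : Fin n → Λ => (x p.1, x p.2) :=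
  (measurable_pi_apply _).prodMk (measurable_pi_apply _)

/-- Disjointness removes the terms with equal indices from the product of the two counts. -/
lemma prod_ncard_eq {Λ : Type*} {n : ℕ} (A B : Set Λ) (hAB : Disjoint A B) (x : Fin n → Λ) :
    (({j : Fin n | x j ∈ A}.ncard : ℕ) : ℝ≥0∞) * (({j : Fin n | x j ∈ B}.ncard : ℕ) : ℝ≥0∞) =
      ∑ p ∈ (Finset.univ : Finset (Fin n)).offDiag,
        (A ×ˢ B).indicator (fun _ => (1 : ℝ≥0∞)) (x p.1, x p.2) := by
  classical
  have h : ∀ A : Set Λ, (({j : Fin n | x j ∈ A}.ncard : ℕ) : ℝ≥0∞) =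
      ∑ j, A.indicator (fun _ => (1 : ℝ≥0∞)) (x j) := fun A => by
    rw [Set.ncard_eq_toFinset_card', Finset.card_eq_sum_ones]
    push_cast
    simp [Set.indicator_apply]
  rw [h, h, Finset.sum_mul_sum, ← Finset.sum_product', Finset.univ_product_univ]
  symm
  refine Finset.sum_subset_zero_on_sdiff (Finset.subset_univ _) ?_ ?_
  · intro p hp
    have hp' : p.1 = p.2 := by simpa using hp
    rw [hp']
    by_cases h1 : x p.2 ∈ A
    · rw [Set.indicator_of_notMem (Set.disjoint_left.1 hAB h1), mul_zero]
    · rw [Set.indicator_of_notMem h1, zero_mul]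
  · intro p _
    by_cases h1 : x p.1 ∈ A <;> by_cases h2 : x p.2 ∈ B <;> simp [h1, h2]

lemma pairMeasure_prod_eq {Λ : Type*} [MeasurableSpace Λ] {μ : Measure Λ} [SigmaFinite μ] {n : ℕ}
    {P : Measure (Fin n → Λ)} {ρ : (Fin 2 → Λ) → NNReal} (hρ : IsIntensity μ P 2 ρ)
    {A B : Set Λ} (hA : MeasurableSet A) (hB : MeasurableSet B) (hAB : Disjoint A B) :
    pairMeasure P (A ×ˢ B) = (μ.prod μ).withDensity (fun q => (ρ ![q.1, q.2] : ℝ≥0∞)) (A ×ˢ B) := by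
  have h := hρ.moment ![A, B] (fun i => by fin_cases i <;> simpa)
    (fun i j hij => by
      fin_cases i <;> fin_cases j
      · exact absurd rfl hij
      · simpa using hAB
      · simpa using hAB.symm
      · exact absurd rfl hij)
  simp only [Fin.prod_univ_two, Matrix.cons_val_zero, Matrix.cons_val_one] at h
  rw [withDensity_apply _ (hA.prod hB)]
  have e := (measurePreserving_finTwoArrow μ).symm.setLIntegral_comp_preimage_emb
    (MeasurableEquiv.measurableEmbedding _) (fun y => (ρ y : ℝ≥0∞)) (Set.pi univ ![A, B])
  have hpre : (MeasurableEquiv.finTwoArrow.symm : Λ × Λ → Fin 2 → Λ) ⁻¹' (Set.pi univ ![A, B]) =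
      A ×ˢ B := by
    ext q
    simp [Set.mem_pi, Fin.forall_fin_two]
  rw [hpre] at e
  rw [← e] at h
  have e2 : ∀ q : Λ × Λ, (MeasurableEquiv.finTwoArrow.symm : Λ × Λ → Fin 2 → Λ) q =
      ![q.1, q.2] := fun q => by
    ext i; fin_cases i <;> rfl
  simp only [e2] at h
  rw [← h]
  simp_rw [prod_ncard_eq A B hAB]
  rw [lintegral_finsetSum]
  · rw [pairMeasure, Measure.finsetSum_apply]
    refine Finset.sum_congr rfl fun p _ => ?_
    rw [Measure.map_apply (measurable_pair p) (hA.prod hB)]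
    rw [← lintegral_indicator_one ((measurable_pair p) (hA.prod hB))]
    rfl
  · intro p _
    exact (measurable_const.indicator (hA.prod hB)).comp (measurable_pair p)

/-- The second factorial moment measure has density `ρ`. -/
lemma pairMeasure_eq_withDensity {Λ : Type*} [TopologicalSpace Λ] [T2Space Λ]
    [SecondCountableTopology Λ] [MeasurableSpace Λ] [BorelSpace Λ] {μ : Measure Λ} [SigmaFinite μ]
    {n : ℕ} {P : Measure (Fin n → Λ)} [IsProbabilityMeasure P] (hP : ∀ᵐ x ∂P, Function.Injective x)
    {ρ : (Fin 2 → Λ) → NNReal} (hρ : IsIntensity μ P 2 ρ) :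
    pairMeasure P = (μ.prod μ).withDensity fun q => (ρ ![q.1, q.2] : ℝ≥0∞) := by
  set ν := (μ.prod μ).withDensity fun q => (ρ ![q.1, q.2] : ℝ≥0∞) with hν
  have hdiag : MeasurableSet (diagonal Λ) := isClosed_diagonal.measurableSet
  have hd1 : pairMeasure P (diagonal Λ) = 0 := by
    rw [pairMeasure, Measure.finsetSum_apply]
    refine Finset.sum_eq_zero fun p hp => ?_
    rw [Measure.map_apply (measurable_pair p) hdiag]
    refine measure_mono_null (t := {x | ¬ Function.Injective x}) ?_ hP
    intro x hx hinj
    exact (Finset.mem_offDiag.1 hp).2.2 (hinj hx)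
  have hd2 : ν (diagonal Λ) = 0 := by
    rw [hν, withDensity_apply _ hdiag]
    refine (setLIntegral_congr_fun hdiag fun q hq => ?_).trans (lintegral_zero)
    rw [hρ.diagonal, ENNReal.coe_zero]
    intro hinj
    have : q.1 = q.2 := hq
    exact absurd (hinj (a₁ := 0) (a₂ := 1) (by simpa using this)) (by simp)
  -- The moment formula only sees products of disjoint sets, but the complement of the diagonal is a
  -- countable union of such products of basic open sets. The diagonal itself is null for both
  -- measures.
  have hcompl : (pairMeasure P).restrict (diagonal Λ)ᶜ = ν.restrict (diagonal Λ)ᶜ := by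
    set b := TopologicalSpace.countableBasis Λ
    have hcount : Countable b := (TopologicalSpace.countable_countableBasis Λ).to_subtype
    set ι := {p : b × b // Disjoint (p.1 : Set Λ) (p.2 : Set Λ)}
    have hcover : (diagonal Λ)ᶜ = ⋃ p : ι, (p.1.1 : Set Λ) ×ˢ (p.1.2 : Set Λ) := by
      ext q
      simp only [mem_compl_iff, mem_diagonal_iff, mem_iUnion, mem_prod]
      constructor
      · intro hq
        obtain ⟨u, v, hu, hv, hqu, hqv, huv⟩ := t2_separation hq
        obtain ⟨u', hu', hqu', huu'⟩ :=
          (TopologicalSpace.isBasis_countableBasis Λ).exists_subset_of_mem_open hqu hu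
        obtain ⟨v', hv', hqv', hvv'⟩ :=
          (TopologicalSpace.isBasis_countableBasis Λ).exists_subset_of_mem_open hqv hv
        exact ⟨⟨(⟨u', hu'⟩, ⟨v', hv'⟩), huv.mono huu' hvv'⟩, hqu', hqv'⟩
      · rintro ⟨p, h1, h2⟩ heq
        rw [heq] at h1
        exact Set.disjoint_left.1 p.2 h1 h2
    rw [hcover, Measure.restrict_iUnion_congr]
    intro p
    have hm : ∀ u : b, MeasurableSet (u : Set Λ) := fun u =>
      (TopologicalSpace.isOpen_of_mem_countableBasis u.2).measurableSet
    have : IsFiniteMeasure (pairMeasure P) := by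
      unfold pairMeasure; infer_instance
    refine Measure.ext_prod fun {A B} hA hB => ?_
    rw [Measure.restrict_apply (hA.prod hB), Measure.restrict_apply (hA.prod hB), prod_inter_prod]
    exact pairMeasure_prod_eq hρ (hA.inter (hm _)) (hB.inter (hm _))
      (p.2.mono inter_subset_right inter_subset_right)
  ext s hs
  have h1 := congrArg (fun m : Measure (Λ × Λ) => m s) hcompl
  simp only [Measure.restrict_apply hs] at h1
  have hsplit : ∀ m : Measure (Λ × Λ), m (diagonal Λ) = 0 → m s = m (s ∩ (diagonal Λ)ᶜ) :=
    fun m hm => by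
      rw [← measure_inter_add_sdiff s hdiag, measure_mono_null inter_subset_right hm, zero_add,
        sdiff_eq]
  rw [hsplit _ hd1, hsplit _ hd2, h1]

end PointProcess

/-! ### Expected pair statistics of the Harmonic ensemble. -/

section ExpectedPairSum

open MeasureTheory Set

/-- `log (1 + |x - y| / 2)` for unit vectors, in terms of `t = ⟨x, y⟩`. -/
noncomputable def pairLog (t : ℝ) : ℝ := Real.log (1 + √((1 - t) / 2))

lemma pairLog_nonneg (t : ℝ) : 0 ≤ pairLog t :=
  Real.log_nonneg (by linarith [Real.sqrt_nonneg ((1 - t) / 2)])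

lemma pairLog_le (t : ℝ) : pairLog t ≤ √((1 - t) / 2) := by
  have h := Real.sqrt_nonneg ((1 - t) / 2)
  have := Real.log_le_sub_one_of_pos (by linarith : 0 < 1 + √((1 - t) / 2))
  unfold pairLog
  linarith

lemma continuous_pairLog : Continuous pairLog := by
  refine Continuous.log (by fun_prop) fun t => ?_
  have := Real.sqrt_nonneg ((1 - t) / 2)
  positivity

lemma integral_log_one_add_mul : ∫ u in (0 : ℝ)..1, Real.log (1 + u) * u = 1 / 4 := by
  have hd : ∀ u ∈ uIcc (0 : ℝ) 1,
      HasDerivAt (fun u : ℝ => ((u ^ 2 - 1) * Real.log (1 + u) - u ^ 2 / 2 + u) / 2)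
        (Real.log (1 + u) * u) u := fun u hu => by
    rw [uIcc_of_le zero_le_one] at hu
    have hu1 : (1 + u) ≠ 0 := by linarith [hu.1]
    have hl : HasDerivAt (fun u : ℝ => Real.log (1 + u)) (1 / (1 + u)) u := by
      have := ((hasDerivAt_id u).const_add 1).log hu1
      simpa using this
    have := (((((hasDerivAt_pow 2 u).sub_const 1).mul hl).sub
      ((hasDerivAt_pow 2 u).div_const 2)).add (hasDerivAt_id u)).div_const 2
    refine this.congr_deriv ?_
    field_simp
    push_cast
    ring
  rw [intervalIntegral.integral_eq_sub_of_hasDerivAt hd]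
  · norm_num
  · apply ContinuousOn.intervalIntegrable
    rw [uIcc_of_le zero_le_one]
    refine ContinuousOn.mul (ContinuousOn.log (by fun_prop) fun u hu => ?_) continuousOn_id
    linarith [hu.1]

/-- The substitution t = 1 - 2u² makes u half the chord. The value 1 fixes the leading coefficient
-1/4 of the energy. -/
lemma integral_pairLog : ∫ t in (-1 : ℝ)..1, pairLog t = 1 := by
  have h1 := intervalIntegral.integral_comp_mul_deriv (a := 0) (b := 1)
    (f := fun u : ℝ => 1 - 2 * u ^ 2) (f' := fun u => -(4 * u))
    (fun u _ => by
      have := ((hasDerivAt_pow 2 u).const_mul 2).const_sub 1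
      refine this.congr_deriv ?_
      push_cast
      ring) (by fun_prop) continuous_pairLog
  rw [show (1 : ℝ) - 2 * 0 ^ 2 = 1 by norm_num, show (1 : ℝ) - 2 * 1 ^ 2 = -1 by norm_num,
    intervalIntegral.integral_symm (-1) 1] at h1
  have h2 : ∫ u in (0 : ℝ)..1, (pairLog ∘ fun u : ℝ => 1 - 2 * u ^ 2) u * -(4 * u) =
      ∫ u in (0 : ℝ)..1, -4 * (Real.log (1 + u) * u) := by
    refine intervalIntegral.integral_congr fun u hu => ?_
    rw [uIcc_of_le zero_le_one] at hu
    simp only [pairLog, Function.comp_apply]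
    rw [show (1 - (1 - 2 * u ^ 2)) / 2 = u ^ 2 by ring, Real.sqrt_sq hu.1]
    ring
  rw [h2, intervalIntegral.integral_const_mul, integral_log_one_add_mul] at h1
  linarith

lemma eval_one_derivative_legendre (n : ℕ) :
    (Polynomial.derivative (legendre n)).eval 1 = (n : ℝ) * (n + 1) / 2 := by
  induction n with
  | zero => simp [legendre_zero]
  | succ n ih =>
    rw [derivative_legendre_succ]
    simp [ih, (eval_one_legendre n).1]
    ring

lemma eval_one_zonal (L : ℕ) : (zonal L).eval 1 = ((L : ℝ) + 1) ^ 2 := by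
  simp [zonal, eval_one_derivative_legendre]
  ring

lemma inner_self_S2 (x : S2) : inner ℝ (x : E3) (x : E3) = (1 : ℝ) := by
  rw [real_inner_self_eq_norm_sq, norm_S2, one_pow]

/-- The expectation of a pair statistic of the Harmonic ensemble. -/
lemma integral_pair_statistic {L : ℕ} (hL : 1 ≤ L) {P : Measure (Fin ((L + 1) ^ 2) → S2)}
    (hP : IsHarmonicEnsemble L P) (g : ℝ → ℝ) (hg : Continuous g) :
    ∫ x, ∑ p ∈ (Finset.univ : Finset (Fin ((L + 1) ^ 2))).offDiag,
        g (inner ℝ (x p.1 : E3) (x p.2 : E3)) ∂P =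
      1 / 2 * (((L : ℝ) + 1) ^ 4 * (∫ t in (-1 : ℝ)..1, g t) -
        ∫ t in (-1 : ℝ)..1, (zonal L).eval t ^ 2 * g t) := by
  obtain ⟨K, hK, hD⟩ := hP
  have := hD.prob
  -- Two-point intensities are available only with at least two points, hence the condition 1 ≤ L.
  obtain ⟨ρ, hρ, hdet⟩ := hD.intensity 2 (by norm_num) (by nlinarith)
  have hpi := Real.pi_pos
  set F : S2 × S2 → ℝ := fun q => g (inner ℝ (q.1 : E3) (q.2 : E3)) with hF
  have hFc : Continuous F := by fun_prop
  have hρe : ∀ q : S2 × S2, (ρ ![q.1, q.2] : ℝ) =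
      (((L : ℝ) + 1) ^ 4 - (zonal L).eval (inner ℝ (q.1 : E3) (q.2 : E3)) ^ 2) /
        (16 * Real.pi ^ 2) := fun q => by
    have h := hdet ![q.1, q.2]
    rw [Matrix.det_fin_two] at h
    simp only [Matrix.of_apply, Matrix.cons_val_zero, Matrix.cons_val_one, kernel_eq_zonal hK,
      inner_self_S2, eval_one_zonal] at h
    rw [real_inner_comm (q.1 : E3) (q.2 : E3)] at h
    have h' : (ρ ![q.1, q.2] : ℝ) = ((L : ℝ) + 1) ^ 2 / (4 * Real.pi) *
        (((L : ℝ) + 1) ^ 2 / (4 * Real.pi)) -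
        (zonal L).eval (inner ℝ (q.1 : E3) (q.2 : E3)) / (4 * Real.pi) *
        ((zonal L).eval (inner ℝ (q.1 : E3) (q.2 : E3)) / (4 * Real.pi)) := by exact_mod_cast h
    rw [h']
    field_simp
    ring
  -- Measurability is not part of `IsIntensity`; it is read off the explicit formula.
  have hρm : Measurable fun q : S2 × S2 => ρ ![q.1, q.2] := by
    have : (fun q : S2 × S2 => ρ ![q.1, q.2]) = fun q => Real.toNNReal
        ((((L : ℝ) + 1) ^ 4 - (zonal L).eval (inner ℝ (q.1 : E3) (q.2 : E3)) ^ 2) /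
        (16 * Real.pi ^ 2)) := by
      ext q
      rw [← hρe, Real.toNNReal_coe]
    rw [this]
    apply Measurable.real_toNNReal
    apply Continuous.measurable
    fun_prop
  obtain ⟨C, hC⟩ : ∃ C, ∀ q, ‖F q‖ ≤ C := by
    obtain ⟨C, hC⟩ := isCompact_univ.exists_bound_of_continuousOn hFc.continuousOn
    exact ⟨C, fun q => hC q (mem_univ q)⟩
  have hmeas : ∀ p : Fin ((L + 1) ^ 2) × Fin ((L + 1) ^ 2),
      Measurable fun x : Fin ((L + 1) ^ 2) → S2 => (x p.1, x p.2) := measurable_pair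
  have hint : ∀ p : Fin ((L + 1) ^ 2) × Fin ((L + 1) ^ 2),
      Integrable F (P.map fun x => (x p.1, x p.2)) := fun p => by
    have : IsFiniteMeasure (P.map fun x => (x p.1, x p.2)) := inferInstance
    exact Integrable.of_bound hFc.aestronglyMeasurable C (Filter.Eventually.of_forall hC)
  have h1 : ∫ x, ∑ p ∈ (Finset.univ : Finset (Fin ((L + 1) ^ 2))).offDiag,
        g (inner ℝ (x p.1 : E3) (x p.2 : E3)) ∂P = ∫ q, F q ∂(pairMeasure P) := by
    rw [pairMeasure, integral_finsetSum_measure fun p _ => hint p, integral_finsetSum]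
    · refine Finset.sum_congr rfl fun p _ => ?_
      rw [integral_map (hmeas p).aemeasurable hFc.aestronglyMeasurable]
    · intro p _
      exact (hint p).comp_measurable (hmeas p)
  -- The inner integral does not depend on y; integrating over y gives 4π, and 2π · 4π / (16π²) =
  -- 1/2.
  have h2 : ∀ y : S2, ∫ x : S2, (ρ ![x, y] : ℝ) * F (x, y) ∂surfaceMeasure =
      2 * Real.pi * ((16 * Real.pi ^ 2)⁻¹ * (((L : ℝ) + 1) ^ 4 * (∫ t in (-1 : ℝ)..1, g t) -
        ∫ t in (-1 : ℝ)..1, (zonal L).eval t ^ 2 * g t)) := fun y => by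
    have e : ∀ x : S2, (ρ ![x, y] : ℝ) * F (x, y) =
      (fun t => (16 * Real.pi ^ 2)⁻¹ * (((L : ℝ) + 1) ^ 4 * g t - (zonal L).eval t ^ 2 * g t))
        (inner ℝ (x : E3) (y : E3)) := fun x => by
      rw [hρe (x, y)]
      simp only [hF]
      ring
    refine (integral_congr_ae (Filter.Eventually.of_forall e)).trans
      ((integral_S2_inner (fun t => (16 * Real.pi ^ 2)⁻¹ *
        (((L : ℝ) + 1) ^ 4 * g t - (zonal L).eval t ^ 2 * g t)) (by fun_prop) y).trans ?_)
    rw [intervalIntegral.integral_const_mul,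
      intervalIntegral.integral_sub, intervalIntegral.integral_const_mul]
    · apply Continuous.intervalIntegrable
      fun_prop
    · apply Continuous.intervalIntegrable
      fun_prop
  rw [h1, pairMeasure_eq_withDensity hD.simple_points hρ,
    integral_withDensity_eq_integral_smul hρm]
  simp_rw [NNReal.smul_def, smul_eq_mul]
  rw [integral_prod_symm]
  · simp_rw [h2]
    rw [integral_const, surfaceMeasure_real_univ, smul_eq_mul]
    field_simp
    ring
  · simp_rw [hρe]
    apply Continuous.integrable_of_hasCompactSupport
    · fun_prop
    · exact HasCompactSupport.of_compactSpace _

/-- The number of pairs up to the negative correlation, which is of order `L log L`. -/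
lemma integral_pairLog_sum_bounds {L : ℕ} (hL : 1 ≤ L) {P : Measure (Fin ((L + 1) ^ 2) → S2)}
    (hP : IsHarmonicEnsemble L P) :
    |(∫ x, ∑ p ∈ (Finset.univ : Finset (Fin ((L + 1) ^ 2))).offDiag,
        pairLog (inner ℝ (x p.1 : E3) (x p.2 : E3)) ∂P) - ((L : ℝ) + 1) ^ 4 / 2| ≤
      8 * Real.pi * (L + 1) * (1 + Real.log (L + 2)) := by
  rw [integral_pair_statistic hL hP _ continuous_pairLog, integral_pairLog]
  have h0 : 0 ≤ ∫ t in (-1 : ℝ)..1, (zonal L).eval t ^ 2 * pairLog t :=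
    intervalIntegral.integral_nonneg (by norm_num) fun t _ =>
      mul_nonneg (sq_nonneg _) (pairLog_nonneg t)
  have h1 : ∫ t in (-1 : ℝ)..1, (zonal L).eval t ^ 2 * pairLog t ≤
      ∫ t in (-1 : ℝ)..1, (zonal L).eval t ^ 2 * √((1 - t) / 2) := by
    have := continuous_pairLog
    refine intervalIntegral.integral_mono_on (by norm_num) ?_ ?_ fun t _ =>
      mul_le_mul_of_nonneg_left (pairLog_le t) (sq_nonneg _)
    · apply Continuous.intervalIntegrable
      fun_prop
    · apply Continuous.intervalIntegrable
      fun_prop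
  have h2 := integral_zonal_sq_mul_sqrt_le L
  rw [abs_le]
  constructor <;> linarith

end ExpectedPairSum

/-! ### Distances and averages of the logarithmic kernel along Hopf fibres. -/

section Fibre

open MeasureTheory Set

abbrev E4 : Type := EuclideanSpace ℝ (Fin 4)

lemma norm_S3 (y : S3) : ‖(y : E4)‖ = 1 := mem_sphere_zero_iff_norm.1 y.2

lemma norm_sub_S3_sq (y y' : S3) :
    ‖(y : E4) - (y' : E4)‖ ^ 2 = 2 - 2 * inner ℝ (y : E4) (y' : E4) := by
  rw [norm_sub_sq_real, norm_S3, norm_S3]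
  ring

lemma norm_sub_S3_le (y y' : S3) : ‖(y : E4) - (y' : E4)‖ ≤ 2 := by
  refine (norm_sub_le _ _).trans ?_
  rw [norm_S3, norm_S3]
  norm_num

lemma inner_E4 (v w : E4) : inner ℝ v w = v 0 * w 0 + v 1 * w 1 + v 2 * w 2 + v 3 * w 3 := by
  simp [PiLp.inner_apply, Fin.sum_univ_four]
  ring

lemma inner_E3 (v w : E3) : inner ℝ v w = v 0 * w 0 + v 1 * w 1 + v 2 * w 2 := by
  simp [PiLp.inner_apply, Fin.sum_univ_three]
  ring

/-- The inner product of a moving point of a Hopf fibre with a fixed point is sinusoidal, with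
amplitude given by the base points. -/
lemma exists_inner_fibrePoint (p : S2) (y : S3) : ∃ A B : ℝ,
    A ^ 2 + B ^ 2 = (1 + inner ℝ (p : E3) (hopf y : E3)) / 2 ∧
    ∀ t : ℝ, inner ℝ (fibrePoint p t : E4) (y : E4) = A * Real.cos t + B * Real.sin t := by
  have hp := sum_sq_S2 p
  have hy := sum_sq_S3 y
  by_cases h : (p : E3) 0 = -1
  · have h1 : (p : E3) 1 = 0 := by
      rw [h] at hp
      nlinarith [sq_nonneg ((p : E3) 1), sq_nonneg ((p : E3) 2)]
    have h2 : (p : E3) 2 = 0 := by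
      rw [h] at hp
      nlinarith [sq_nonneg ((p : E3) 1), sq_nonneg ((p : E3) 2)]
    refine ⟨(y : E4) 2, (y : E4) 3, ?_, fun t => ?_⟩
    · rw [inner_E3, h, h1, h2]
      simp [hopf]
      linarith
    · rw [inner_E4]
      simp [fibrePoint, fibreVec, h]
      ring
  · have hs := inv_sqrt_sq p h
    set s := 1 / Real.sqrt (2 * (1 + (p : E3) 0)) with hsdef
    refine ⟨s * ((1 + (p : E3) 0) * (y : E4) 0 - (p : E3) 2 * (y : E4) 2 + (p : E3) 1 * (y : E4) 3),
      s * ((1 + (p : E3) 0) * (y : E4) 1 + (p : E3) 1 * (y : E4) 2 + (p : E3) 2 * (y : E4) 3),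
      ?_, fun t => ?_⟩
    · rw [inner_E3]
      simp [hopf]
      set a := (y : E4) 0
      set b := (y : E4) 1
      set c := (y : E4) 2
      set d := (y : E4) 3
      set p0 := (p : E3) 0
      set p1 := (p : E3) 1
      set p2 := (p : E3) 2
      linear_combination (1 / 2) * (1 * (1 + p0 * (a ^ 2 + b ^ 2 - c ^ 2 - d ^ 2)
        + p1 * (2 * (a * d + b * c)) + p2 * (2 * (b * d - a * c)))) * hs
        + s ^ 2 * (c ^ 2 + d ^ 2) * hp + s ^ 2 * (1 + p0) * hy
    · rw [inner_E4]
      simp only [fibrePoint, fibreVec, h, if_false, ← hsdef]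
      simp
      ring

lemma inner_S2_mem (p q : S2) : inner ℝ (p : E3) (q : E3) ∈ Icc (-1 : ℝ) 1 := by
  have := abs_real_inner_le_norm (p : E3) (q : E3)
  rw [norm_S2, norm_S2, mul_one] at this
  exact abs_le.1 this

/-- The distance from a point of a Hopf fibre to a fixed point, as the distance in the plane from
a point of a circle to a point in the disc it bounds. -/
lemma exists_norm_fibrePoint_sub (p : S2) (y : S3) (δ : ℝ) :
    ∃ b : ℂ, ‖b‖ ≤ √(1 + √((1 - inner ℝ (p : E3) (hopf y : E3)) / 2)) ∧
    ∀ t : ℝ, ‖(fibrePoint p (t + δ) : E4) - (y : E4)‖ =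
      ‖circleMap 0 (√(1 + √((1 - inner ℝ (p : E3) (hopf y : E3)) / 2))) t - b‖ := by
  obtain ⟨A, B, hAB, hinner⟩ := exists_inner_fibrePoint p y
  have hc := inner_S2_mem p (hopf y)
  set c := inner ℝ (p : E3) (hopf y : E3)
  -- Matching 2 - 2(A cos t + B sin t) with |α e^{it} - b|² requires α² + |b|² = 2 and α|b| = √(A² +
  -- B²) = √(1 - w²), so the two squares are 1 ± w. The larger is taken for α², which puts b in the
  -- disc.
  set w := √((1 - c) / 2) with hw
  have hw0 : 0 ≤ w := Real.sqrt_nonneg _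
  have hw2 : w ^ 2 = (1 - c) / 2 := Real.sq_sqrt (by linarith [hc.2])
  set α := √(1 + w) with hα
  have hα2 : α ^ 2 = 1 + w := Real.sq_sqrt (by linarith)
  have hα0 : 0 < α := Real.sqrt_pos.2 (by linarith)
  have hsum : A ^ 2 + B ^ 2 = 1 - w ^ 2 := by rw [hAB, hw2]; ring
  have hdiv : (A ^ 2 + B ^ 2) / α ^ 2 = 1 - w := by
    rw [hsum, hα2]
    field_simp
    ring
  -- This is (A + iB) e^{-iδ} / α; the rotation absorbs the phase shift.
  set b : ℂ := ((A * Real.cos δ + B * Real.sin δ) / α : ℝ) +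
    ((B * Real.cos δ - A * Real.sin δ) / α : ℝ) * Complex.I with hb
  have hδ := Real.sin_sq_add_cos_sq δ
  have hbn : ‖b‖ ^ 2 = 1 - w := by
    rw [← Complex.normSq_eq_norm_sq, hb, Complex.normSq_add_mul_I, ← hdiv]
    field_simp
    linear_combination (A ^ 2 + B ^ 2) * hδ
  refine ⟨b, ?_, fun t => ?_⟩
  · refine abs_le_of_sq_le_sq' ?_ hα0.le |>.2
    rw [hbn, hα2]
    linarith
  · refine (sq_eq_sq₀ (norm_nonneg _) (norm_nonneg _)).1 ?_
    have ht := Real.sin_sq_add_cos_sq t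
    have hz : circleMap 0 α t - b =
        ((α * Real.cos t - (A * Real.cos δ + B * Real.sin δ) / α : ℝ) : ℂ) +
        ((α * Real.sin t - (B * Real.cos δ - A * Real.sin δ) / α : ℝ) : ℂ) * Complex.I := by
      rw [circleMap, hb, Complex.exp_mul_I, ← Complex.ofReal_cos, ← Complex.ofReal_sin]
      push_cast
      ring
    rw [norm_sub_S3_sq, hinner, hz, ← Complex.normSq_eq_norm_sq, Complex.normSq_add_mul_I,
      Real.cos_add, Real.sin_add]
    have h1 : α * ((A * Real.cos δ + B * Real.sin δ) / α) = A * Real.cos δ + B * Real.sin δ := by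
      field_simp
    have h2 : α * ((B * Real.cos δ - A * Real.sin δ) / α) = B * Real.cos δ - A * Real.sin δ := by
      field_simp
    have h3 : ((A * Real.cos δ + B * Real.sin δ) / α) ^ 2 +
        ((B * Real.cos δ - A * Real.sin δ) / α) ^ 2 = 1 - w := by
      rw [← hdiv]
      field_simp
      linear_combination (A ^ 2 + B ^ 2) * hδ
    linear_combination -h3 - α ^ 2 * ht - hα2 + 2 * Real.cos t * h1 + 2 * Real.sin t * h2

/-- The law of one phase, uniform on `[0, 2π)`. -/
noncomputable def uniformPhase : Measure ℝ :=
  ProbabilityTheory.cond volume (Ico 0 (2 * Real.pi))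

lemma phaseLaw_eq (r : ℕ) : phaseLaw r = Measure.pi fun _ => uniformPhase := rfl

instance : IsProbabilityMeasure uniformPhase := by
  refine ProbabilityTheory.cond_isProbabilityMeasure_of_finite ?_ ?_
  · simp [Real.pi_pos]
  · simp [ENNReal.mul_eq_top]

lemma uniformPhase_eq : uniformPhase =
    (ENNReal.ofReal (2 * Real.pi))⁻¹ • volume.restrict (Ioc 0 (2 * Real.pi)) := by
  rw [uniformPhase, ProbabilityTheory.cond, Real.volume_Ico, sub_zero,
    Measure.restrict_congr_set Ico_ae_eq_Ioc]

lemma integral_uniformPhase (f : ℝ → ℝ) :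
    ∫ t, f t ∂uniformPhase = (2 * Real.pi)⁻¹ * ∫ t in (0 : ℝ)..2 * Real.pi, f t := by
  rw [uniformPhase_eq, integral_smul_measure, intervalIntegral.integral_of_le Real.two_pi_pos.le,
    ENNReal.toReal_inv, ENNReal.toReal_ofReal Real.two_pi_pos.le, smul_eq_mul]

lemma integrable_uniformPhase {f : ℝ → ℝ}
    (hf : IntervalIntegrable f volume 0 (2 * Real.pi)) : Integrable f uniformPhase := by
  rw [uniformPhase_eq]
  refine Integrable.smul_measure ?_ (by simp [Real.pi_pos])
  rwa [intervalIntegrable_iff_integrableOn_Ioc_of_le Real.two_pi_pos.le] at hf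

/-- The average of the logarithmic kernel over a Hopf fibre. -/
lemma integral_log_fibrePoint (p : S2) (y : S3) (δ : ℝ) :
    Integrable (fun t => Real.log (1 / ‖(fibrePoint p (t + δ) : E4) - (y : E4)‖)) uniformPhase ∧
    ∫ t, Real.log (1 / ‖(fibrePoint p (t + δ) : E4) - (y : E4)‖) ∂uniformPhase =
      -(1 / 2) * pairLog (inner ℝ (p : E3) (hopf y : E3)) := by
  obtain ⟨b, hb, hdist⟩ := exists_norm_fibrePoint_sub p y δ
  simp only [hdist, one_div, Real.log_inv]
  set w := √((1 - inner ℝ (p : E3) (hopf y : E3)) / 2) with hw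
  have hw0 : 0 ≤ w := Real.sqrt_nonneg _
  set α := √(1 + w) with hα
  have hα0 : 0 < α := Real.sqrt_pos.2 (by linarith)
  have hci : CircleIntegrable (fun z => Real.log ‖z - b‖) 0 α :=
    circleIntegrable_log_norm_sub_const α
  refine ⟨integrable_uniformPhase hci.neg, ?_⟩
  -- Jensen's formula: the log⁺ term vanishes as |b| ≤ α. The boundary case |b| = α is included, so
  -- y may lie on the fibre itself and no exceptional base points arise.
  have hav := circleAverage_log_norm_sub_const_eq_log_radius_add_posLog (c := 0) (a := b) hα0.ne'
  rw [zero_sub, norm_neg, Real.posLog_eq_zero_iff _ |>.2, add_zero, Real.circleAverage_def,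
    smul_eq_mul] at hav
  · rw [integral_neg, integral_uniformPhase, hav, hα, Real.log_sqrt (by linarith), pairLog]
    ring
  · rw [abs_of_nonneg (by positivity), inv_mul_le_iff₀ hα0, mul_one]
    exact hb

/-- Distances on the sphere are at most 2, so the kernel is bounded below by -log 2, and its L¹ norm
is controlled by its integral. -/
lemma abs_log_one_div_le {d : ℝ} (h0 : 0 ≤ d) (h2 : d ≤ 2) :
    |Real.log (1 / d)| ≤ Real.log (1 / d) + 2 * Real.log 2 := by
  have hl2 := Real.log_pos one_lt_two
  rcases h0.eq_or_lt with rfl | hd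
  · simp
    linarith
  · have := Real.log_le_log hd h2
    rw [one_div, Real.log_inv]
    rcases abs_cases (-Real.log d) with h | h <;> linarith

lemma integral_abs_log_fibrePoint_le (p : S2) (y : S3) (δ : ℝ) :
    ∫ t, ‖Real.log (1 / ‖(fibrePoint p (t + δ) : E4) - (y : E4)‖)‖ ∂uniformPhase ≤
      2 * Real.log 2 := by
  obtain ⟨hi, he⟩ := integral_log_fibrePoint p y δ
  calc _ ≤ ∫ t, (Real.log (1 / ‖(fibrePoint p (t + δ) : E4) - (y : E4)‖) + 2 * Real.log 2)
        ∂uniformPhase :=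
        integral_mono hi.norm (hi.add (integrable_const _)) fun t =>
          abs_log_one_div_le (norm_nonneg _) (norm_sub_S3_le _ _)
    _ ≤ _ := by
        rw [integral_add hi (integrable_const _), he]
        simp
        exact pairLog_nonneg _

lemma measurable_fibreVec : Measurable fun q : S2 × ℝ => fibreVec q.1 q.2 := by
  unfold fibreVec
  refine Measurable.ite ?_ ?_ ?_
  · exact (isClosed_eq (by fun_prop) continuous_const).measurableSet
  · apply Continuous.measurable
    fun_prop
  · refine Measurable.smul (f := fun q : S2 × ℝ => 1 / √(2 * (1 + (q.1 : E3) 0))) ?_ ?_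
    · exact Measurable.const_div (Continuous.measurable (by fun_prop)) _
    · apply Continuous.measurable
      fun_prop

lemma inner_fibrePoint_same (p : S2) (t s : ℝ) :
    inner ℝ (fibrePoint p t : E4) (fibrePoint p s : E4) = Real.cos (t - s) := by
  have hp := sum_sq_S2 p
  rw [Real.cos_sub, inner_E4]
  by_cases h : (p : E3) 0 = -1
  · simp [fibrePoint, fibreVec, h]
  · have hs := inv_sqrt_sq p h
    simp only [fibrePoint, fibreVec, h, if_false]
    set σ := 1 / Real.sqrt (2 * (1 + (p : E3) 0)) with hsdef
    simp
    set p0 := (p : E3) 0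
    set p1 := (p : E3) 1
    set p2 := (p : E3) 2
    linear_combination (Real.cos t * Real.cos s + Real.sin t * Real.sin s) * hs
      + σ ^ 2 * (Real.cos t * Real.cos s + Real.sin t * Real.sin s) * hp

/-- The fibre is parametrized isometrically by the unit circle, so its internal energy is that of
roots of unity. -/
lemma norm_fibrePoint_sub_same (p : S2) (t s : ℝ) :
    ‖(fibrePoint p t : E4) - (fibrePoint p s : E4)‖ =
      ‖Complex.exp (t * Complex.I) - Complex.exp (s * Complex.I)‖ := by
  refine (sq_eq_sq₀ (norm_nonneg _) (norm_nonneg _)).1 ?_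
  have hz : Complex.exp (t * Complex.I) - Complex.exp (s * Complex.I) =
      ((Real.cos t - Real.cos s : ℝ) : ℂ) + ((Real.sin t - Real.sin s : ℝ) : ℂ) * Complex.I := by
    rw [Complex.exp_mul_I, Complex.exp_mul_I, ← Complex.ofReal_cos, ← Complex.ofReal_sin,
      ← Complex.ofReal_cos, ← Complex.ofReal_sin]
    push_cast
    ring
  rw [norm_sub_S3_sq, inner_fibrePoint_same, hz, ← Complex.normSq_eq_norm_sq,
    Complex.normSq_add_mul_I, Real.cos_sub]
  linear_combination -Real.sin_sq_add_cos_sq t - Real.sin_sq_add_cos_sq s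

end Fibre

/-! ### Exact expected energy of the lifted configuration. -/

section ExpectedEnergy

open MeasureTheory Set

/-- The product of 1 - ζ^c over 1 ≤ c ≤ m is m + 1; the term c = 0 adds nothing, since `Real.log 0 =
0`. -/
lemma sum_log_one_sub_pow (m : ℕ) {ζ : ℂ} (hζ : IsPrimitiveRoot ζ (m + 1)) :
    ∑ c : Fin (m + 1), Real.log ‖1 - ζ ^ (c : ℕ)‖ = Real.log ((m : ℝ) + 1) := by
  have h := hζ.prod_one_sub_pow_eq_order
  have h' := congrArg (fun z : ℂ => ‖z‖) h
  simp only [norm_prod] at h'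
  rw [Fin.sum_univ_succ]
  simp only [Fin.val_zero, pow_zero, sub_self, norm_zero, Real.log_zero, zero_add, Fin.val_succ]
  rw [Fin.sum_univ_eq_sum_range (fun c => Real.log ‖1 - ζ ^ (c + 1)‖) m, ← Real.log_prod, h']
  · congr 1
    exact_mod_cast Complex.norm_natCast (m + 1)
  · intro c hc
    rw [norm_ne_zero_iff, sub_ne_zero, ne_comm]
    exact hζ.pow_ne_one_of_pos_of_lt (by omega) (by have := Finset.mem_range.1 hc; omega)

/-- The logarithmic energy of `k` equally spaced points of the unit circle. -/
lemma sum_log_equally_spaced (k : ℕ) (θ : ℝ) : ∑ a : Fin k, ∑ b : Fin k,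
    Real.log (1 / ‖Complex.exp (((θ + 2 * Real.pi * (a : ℕ) / k : ℝ) : ℂ) * Complex.I) -
      Complex.exp (((θ + 2 * Real.pi * (b : ℕ) / k : ℝ) : ℂ) * Complex.I)‖) =
    -((k : ℝ) * Real.log k) := by
  cases k with
  | zero => simp
  | succ m =>
    set ζ : ℂ := Complex.exp (2 * Real.pi * Complex.I / ((m + 1 : ℕ) : ℂ)) with hζdef
    have hζ : IsPrimitiveRoot ζ (m + 1) := Complex.isPrimitiveRoot_exp (m + 1) (by omega)
    have hexp : ∀ a : ℕ,
        Complex.exp (((θ + 2 * Real.pi * a / (m + 1 : ℕ) : ℝ) : ℂ) * Complex.I) =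
          Complex.exp (θ * Complex.I) * ζ ^ a := fun a => by
      rw [hζdef, ← Complex.exp_nat_mul, ← Complex.exp_add]
      push_cast
      ring_nf
    have hζn : ∀ a : ℕ, ‖ζ ^ a‖ = 1 := fun a => by
      rw [norm_pow, hζ.norm'_eq_one (by omega), one_pow]
    have hmod : ∀ a c : Fin (m + 1), ζ ^ ((a + c : Fin (m + 1)) : ℕ) = ζ ^ (a : ℕ) * ζ ^ (c : ℕ) :=
      fun a c => by
        rw [← pow_add, Fin.val_add]
        exact (pow_eq_pow_mod _ hζ.pow_eq_one).symm
    have hrow : ∀ a : Fin (m + 1), ∑ b : Fin (m + 1),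
        Real.log (1 / ‖Complex.exp (((θ + 2 * Real.pi * (a : ℕ) / (m + 1 : ℕ) : ℝ) : ℂ) * Complex.I)
          - Complex.exp (((θ + 2 * Real.pi * (b : ℕ) / (m + 1 : ℕ) : ℝ) : ℂ) * Complex.I)‖) =
        -Real.log ((m : ℝ) + 1) := fun a => by
      rw [← sum_log_one_sub_pow m hζ, ← Finset.sum_neg_distrib, ← Equiv.sum_comp (Equiv.addLeft a)]
      refine Finset.sum_congr rfl fun c _ => ?_
      rw [hexp, hexp, Equiv.coe_addLeft, hmod, one_div, Real.log_inv]
      congr 2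
      rw [show Complex.exp (θ * Complex.I) * ζ ^ (a : ℕ) -
        Complex.exp (θ * Complex.I) * (ζ ^ (a : ℕ) * ζ ^ (c : ℕ)) =
        Complex.exp (θ * Complex.I) * (ζ ^ (a : ℕ) * (1 - ζ ^ (c : ℕ))) by ring, norm_mul,
        norm_mul, hζn, Complex.norm_exp_ofReal_mul_I, one_mul, one_mul]
    rw [Finset.sum_congr rfl fun a _ => hrow a]
    simp

/-- The logarithmic kernel is unbounded, but its sections have uniformly bounded L¹ norms, which
suffices on finite measure spaces. -/
lemma integrable_prod_of_section_bound {α β : Type*} [MeasurableSpace α] [MeasurableSpace β]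
    {μ : Measure α} [IsFiniteMeasure μ] {ν : Measure β} [IsFiniteMeasure ν] {f : α × β → ℝ}
    (hf : Measurable f) (C : ℝ) (hi : ∀ x, Integrable (fun y => f (x, y)) ν)
    (hC : ∀ x, ∫ y, ‖f (x, y)‖ ∂ν ≤ C) : Integrable f (μ.prod ν) := by
  refine (integrable_prod_iff hf.aestronglyMeasurable).2 ⟨Filter.Eventually.of_forall hi, ?_⟩
  refine Integrable.of_bound (hf.norm.aestronglyMeasurable.integral_prod_right') C
    (Filter.Eventually.of_forall fun x => ?_)
  rw [Real.norm_eq_abs, abs_of_nonneg (integral_nonneg fun _ => norm_nonneg _)]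
  exact hC x

lemma measurePreserving_phase_pair {r : ℕ} {i j : Fin r} (hij : i ≠ j) :
    MeasurePreserving (fun θ : Fin r → ℝ => (θ i, θ j)) (phaseLaw r)
      (uniformPhase.prod uniformPhase) := by
  rw [phaseLaw_eq]
  refine ⟨by fun_prop, ?_⟩
  have h := (ProbabilityTheory.iIndepFun_pi (μ := fun _ : Fin r => uniformPhase)
    (X := fun _ => id) fun _ => aemeasurable_id).indepFun hij
  have h' := (ProbabilityTheory.indepFun_iff_map_prod_eq_prod_map_map
    (f := fun θ : Fin r → ℝ => θ i) (g := fun θ : Fin r → ℝ => θ j)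
    (measurable_pi_apply i).aemeasurable (measurable_pi_apply j).aemeasurable).1 h
  have hm : ∀ i : Fin r, (Measure.pi fun _ : Fin r => uniformPhase).map (fun θ => θ i) =
      uniformPhase := fun i => (measurePreserving_eval (fun _ : Fin r => uniformPhase) i).map_eq
  rw [hm, hm] at h'
  exact h'

/-- The logarithmic kernel at points of two Hopf fibres with shifted phases. -/
noncomputable def fibreKernel (δ ε : ℝ) (q : (S2 × S2) × (ℝ × ℝ)) : ℝ :=
  Real.log (1 / ‖(fibrePoint q.1.1 (q.2.1 + δ) : E4) - (fibrePoint q.1.2 (q.2.2 + ε) : E4)‖)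

lemma measurable_fibreKernel (δ ε : ℝ) : Measurable (fibreKernel δ ε) := by
  have h1 : Measurable fun q : (S2 × S2) × (ℝ × ℝ) => fibreVec q.1.1 (q.2.1 + δ) :=
    measurable_fibreVec.comp (by fun_prop :
      Measurable fun q : (S2 × S2) × (ℝ × ℝ) => (q.1.1, q.2.1 + δ))
  have h2 : Measurable fun q : (S2 × S2) × (ℝ × ℝ) => fibreVec q.1.2 (q.2.2 + ε) :=
    measurable_fibreVec.comp (by fun_prop :
      Measurable fun q : (S2 × S2) × (ℝ × ℝ) => (q.1.2, q.2.2 + ε))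
  exact Real.measurable_log.comp ((h1.sub h2).norm.const_div 1)

lemma fibreKernel_phases (δ ε : ℝ) (x : S2 × S2) :
    Integrable (fun τ => fibreKernel δ ε (x, τ)) (uniformPhase.prod uniformPhase) ∧
    (∫ τ, fibreKernel δ ε (x, τ) ∂(uniformPhase.prod uniformPhase) =
      -(1 / 2) * pairLog (inner ℝ (x.1 : E3) (x.2 : E3))) ∧
    ∫ τ, ‖fibreKernel δ ε (x, τ)‖ ∂(uniformPhase.prod uniformPhase) ≤ 2 * Real.log 2 := by
  have hm : Measurable fun τ : ℝ × ℝ => fibreKernel δ ε (x, τ) :=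
    (measurable_fibreKernel δ ε).comp measurable_prodMk_left
  have hs : ∀ s : ℝ, Integrable (fun t => fibreKernel δ ε (x, (t, s))) uniformPhase ∧
      (∫ t, fibreKernel δ ε (x, (t, s)) ∂uniformPhase =
        -(1 / 2) * pairLog (inner ℝ (x.1 : E3) (x.2 : E3))) ∧
      ∫ t, ‖fibreKernel δ ε (x, (t, s))‖ ∂uniformPhase ≤ 2 * Real.log 2 := fun s => by
    have h1 := integral_log_fibrePoint x.1 (fibrePoint x.2 (s + ε)) δ
    have h2 := integral_abs_log_fibrePoint_le x.1 (fibrePoint x.2 (s + ε)) δ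
    rw [hopf_fibrePoint] at h1
    simp only [fibreKernel]
    exact ⟨h1.1, h1.2, h2⟩
  have hint : Integrable (fun τ => fibreKernel δ ε (x, τ)) (uniformPhase.prod uniformPhase) := by
    have := integrable_prod_of_section_bound (μ := uniformPhase) (ν := uniformPhase)
      (f := fun τ => fibreKernel δ ε (x, τ.swap)) (hm.comp measurable_swap) (2 * Real.log 2)
      (fun s => by simpa only [Prod.swap_prod_mk] using (hs s).1)
      fun s => by simpa only [Prod.swap_prod_mk] using (hs s).2.2
    simpa only [Function.comp_def, Prod.swap_swap] using this.swap
  refine ⟨hint, ?_, ?_⟩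
  · rw [integral_prod_symm _ hint]
    simp_rw [(hs _).2.1]
    simp
  · rw [integral_prod_symm _ hint.norm]
    calc _ ≤ ∫ _ : ℝ, 2 * Real.log 2 ∂uniformPhase :=
          integral_mono_of_nonneg (Filter.Eventually.of_forall fun s =>
            integral_nonneg fun _ => norm_nonneg _) (integrable_const _)
            (Filter.Eventually.of_forall fun s => (hs s).2.2)
      _ = _ := by simp

lemma integral_fibreKernel_pair {r : ℕ} (P : Measure (Fin r → S2)) [IsProbabilityMeasure P]
    {i j : Fin r} (hij : i ≠ j) (δ ε : ℝ) :
    Integrable (fun ω : (Fin r → S2) × (Fin r → ℝ) =>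
      fibreKernel δ ε ((ω.1 i, ω.1 j), (ω.2 i, ω.2 j))) (P.prod (phaseLaw r)) ∧
    ∫ ω : (Fin r → S2) × (Fin r → ℝ), fibreKernel δ ε ((ω.1 i, ω.1 j), (ω.2 i, ω.2 j))
        ∂(P.prod (phaseLaw r)) =
      ∫ x, -(1 / 2) * pairLog (inner ℝ (x i : E3) (x j : E3)) ∂P := by
  have : IsProbabilityMeasure (phaseLaw r) := by rw [phaseLaw_eq]; infer_instance
  have hpair : Measurable fun x : Fin r → S2 => (x i, x j) := measurable_pair (i, j)
  have hQ : MeasurePreserving (fun x : Fin r → S2 => (x i, x j)) P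
    (P.map fun x => (x i, x j)) := hpair.measurePreserving P
  have : IsProbabilityMeasure (P.map fun x => (x i, x j)) :=
    Measure.isProbabilityMeasure_map hpair.aemeasurable
  have hmp := hQ.prod (measurePreserving_phase_pair hij)
  have hint : Integrable (fibreKernel δ ε)
      ((P.map fun x => (x i, x j)).prod (uniformPhase.prod uniformPhase)) :=
    integrable_prod_of_section_bound (measurable_fibreKernel δ ε) (2 * Real.log 2)
      (fun x => (fibreKernel_phases δ ε x).1) fun x => (fibreKernel_phases δ ε x).2.2
  refine ⟨hmp.integrable_comp_of_integrable hint, ?_⟩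
  have h1 := integral_map (μ := P.prod (phaseLaw r)) hmp.measurable.aemeasurable
    (f := fibreKernel δ ε) (measurable_fibreKernel δ ε).aestronglyMeasurable
  rw [hmp.map_eq] at h1
  refine h1.symm.trans ?_
  rw [integral_prod _ hint]
  simp_rw [(fibreKernel_phases δ ε _).2.1]
  rw [integral_map hpair.aemeasurable]
  have := continuous_pairLog
  apply Continuous.aestronglyMeasurable
  fun_prop

/-- The energy of a lift, as the contribution of the fibres and that of pairs of fibres. -/
lemma logEnergy_hopfLift_eq {r : ℕ} (k : ℕ) (x : Fin r → S2) (θ : Fin r → ℝ) :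
    logEnergy (hopfLift k x θ) = -((r : ℝ) * (k * Real.log k)) +
      ∑ p ∈ (Finset.univ : Finset (Fin r)).offDiag, ∑ a : Fin k, ∑ b : Fin k,
        fibreKernel (2 * Real.pi * (a : ℕ) / k) (2 * Real.pi * (b : ℕ) / k)
          ((x p.1, x p.2), (θ p.1, θ p.2)) := by
  set T : Fin r × Fin k → Fin r × Fin k → ℝ := fun p q =>
    Real.log (1 / ‖(hopfLift k x θ p : E4) - (hopfLift k x θ q : E4)‖) with hT
  have h1 : logEnergy (hopfLift k x θ) = ∑ p, ∑ q, T p q := by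
    rw [← Finset.sum_product', Finset.univ_product_univ, logEnergy]
    -- Equal indices may be added freely, their term being log (1 / 0) = 0.
    refine Finset.sum_subset (Finset.subset_univ _) fun p _ hp => ?_
    have hp' : p.1 = p.2 := by simpa using hp
    simp [hp']
  have h2 : ∑ p, ∑ q, T p q = ∑ p : Fin r × Fin r, ∑ a, ∑ b, T (p.1, a) (p.2, b) := by
    rw [Fintype.sum_prod_type, Fintype.sum_prod_type]
    refine Finset.sum_congr rfl fun i _ => ?_
    rw [Finset.sum_congr rfl fun a _ => Fintype.sum_prod_type (fun q => T (i, a) q)]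
    rw [Finset.sum_comm]
  have h3 : ∀ i : Fin r, ∑ a, ∑ b, T (i, a) (i, b) = -((k : ℝ) * Real.log k) := fun i => by
    rw [← sum_log_equally_spaced k (θ i)]
    refine Finset.sum_congr rfl fun a _ => Finset.sum_congr rfl fun b _ => ?_
    simp only [hT, hopfLift]
    rw [norm_fibrePoint_sub_same]
  rw [h1, h2, ← Finset.univ_product_univ, ← Finset.diag_union_offDiag,
    Finset.sum_union (Finset.disjoint_diag_offDiag _)]
  congr 1
  rw [Finset.sum_diag, Finset.sum_congr rfl fun i _ => h3 i]
  simp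

lemma integrable_logEnergy_hopfLift {r : ℕ} (k : ℕ) (P : Measure (Fin r → S2))
    [IsProbabilityMeasure P] : Integrable (fun ω : (Fin r → S2) × (Fin r → ℝ) =>
      logEnergy (hopfLift k ω.1 ω.2)) (P.prod (phaseLaw r)) := by
  have : IsProbabilityMeasure (phaseLaw r) := by rw [phaseLaw_eq]; infer_instance
  simp_rw [logEnergy_hopfLift_eq]
  refine (integrable_const _).add (integrable_finsetSum _ fun p hp => integrable_finsetSum _
    fun a _ => integrable_finsetSum _ fun b _ => ?_)
  exact (integral_fibreKernel_pair P (Finset.mem_offDiag.1 hp).2.2 _ _).1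

/-- The expected energy of a lift, in terms of the base process. -/
lemma integral_logEnergy_hopfLift {r : ℕ} (k : ℕ) (P : Measure (Fin r → S2))
    [IsProbabilityMeasure P] : ∫ ω : (Fin r → S2) × (Fin r → ℝ),
      logEnergy (hopfLift k ω.1 ω.2) ∂(P.prod (phaseLaw r)) =
    -((r : ℝ) * (k * Real.log k)) - (k : ℝ) ^ 2 / 2 *
      ∫ x, ∑ p ∈ (Finset.univ : Finset (Fin r)).offDiag,
        pairLog (inner ℝ (x p.1 : E3) (x p.2 : E3)) ∂P := by
  have : IsProbabilityMeasure (phaseLaw r) := by rw [phaseLaw_eq]; infer_instance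
  have hi : ∀ p ∈ (Finset.univ : Finset (Fin r)).offDiag, ∀ δ ε : ℝ, _ := fun p hp δ ε =>
    integral_fibreKernel_pair P (Finset.mem_offDiag.1 hp).2.2 δ ε
  have hpl : ∀ p : Fin r × Fin r,
      Integrable (fun x : Fin r → S2 => pairLog (inner ℝ (x p.1 : E3) (x p.2 : E3))) P :=
    fun p => by
      have := continuous_pairLog
      refine Integrable.of_bound (Continuous.aestronglyMeasurable (by fun_prop)) 1
        (Filter.Eventually.of_forall fun x => ?_)
      rw [Real.norm_eq_abs, abs_of_nonneg (pairLog_nonneg _)]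
      refine (pairLog_le _).trans (Real.sqrt_le_one.2 ?_)
      linarith [(inner_S2_mem (x p.1) (x p.2)).1]
  simp_rw [logEnergy_hopfLift_eq]
  rw [integral_add (integrable_const _) (integrable_finsetSum _ fun p hp => integrable_finsetSum _
    fun a _ => integrable_finsetSum _ fun b _ => (hi p hp _ _).1), integral_const, sub_eq_add_neg]
  congr 1
  · simp
  rw [integral_finsetSum _ fun p hp => integrable_finsetSum _ fun a _ =>
    integrable_finsetSum _ fun b _ => (hi p hp _ _).1, integral_finsetSum _ fun p _ => hpl p,
    Finset.mul_sum, ← Finset.sum_neg_distrib]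
  refine Finset.sum_congr rfl fun p hp => ?_
  rw [integral_finsetSum _ fun a _ => integrable_finsetSum _ fun b _ => (hi p hp _ _).1]
  -- The shifts do not affect the mean, so all k² pairs of points on two fibres contribute equally.
  have : ∀ a : Fin k, ∫ ω : (Fin r → S2) × (Fin r → ℝ), ∑ b : Fin k,
      fibreKernel (2 * Real.pi * (a : ℕ) / k) (2 * Real.pi * (b : ℕ) / k)
        ((ω.1 p.1, ω.1 p.2), (ω.2 p.1, ω.2 p.2)) ∂(P.prod (phaseLaw r)) =
      k * (-(1 / 2) * ∫ x, pairLog (inner ℝ (x p.1 : E3) (x p.2 : E3)) ∂P) := fun a => by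
    rw [integral_finsetSum _ fun b _ => (hi p hp _ _).1,
      Finset.sum_congr rfl fun b _ => (hi p hp _ _).2, integral_const_mul]
    simp
  rw [Finset.sum_congr rfl fun a _ => this a]
  simp
  ring

end ExpectedEnergy

/-! ### Asymptotics for the chosen number of points per fibre. -/

section Asymptotics

/-- Here n stands for √r. With l = log n² and x = n/l, log x = l/2 - log l; the floor changes log x
by at most log 2, and log N lies between l and 2l. Substituting log k ≈ l/2 - log l, log N = log k +
l and log log N ≈ log l, the combination cancels up to multiples of log 2. -/
lemma floor_div_log_sq {n : ℝ} (hn : 3 ≤ n) :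
    1 ≤ ⌊n / Real.log (n ^ 2)⌋₊ ∧ (⌊n / Real.log (n ^ 2)⌋₊ : ℝ) ≤ n / (2 * Real.log n) ∧
    |Real.log ⌊n / Real.log (n ^ 2)⌋₊ - 1 / 3 * Real.log (⌊n / Real.log (n ^ 2)⌋₊ * n ^ 2) +
      2 / 3 * Real.log (Real.log (⌊n / Real.log (n ^ 2)⌋₊ * n ^ 2))| ≤ 2 := by
  have hl1 : 1 ≤ Real.log n := by
    rw [Real.le_log_iff_exp_le (by linarith)]
    linarith [Real.exp_one_lt_d9]
  have hl2 : Real.log n ≤ n / 2 := by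
    have h := Real.log_le_sub_one_of_pos (by linarith : 0 < n / 2)
    rw [Real.log_div (by linarith) two_ne_zero] at h
    linarith [Real.log_two_lt_d9]
  have hsq : Real.log (n ^ 2) = 2 * Real.log n := by
    rw [Real.log_pow]; norm_num
  rw [hsq]
  set l := 2 * Real.log n with hl
  set x := n / l with hx
  have hl0 : 0 < l := by linarith
  have hx1 : 1 ≤ x := by rw [hx, le_div_iff₀ hl0]; linarith
  set k := ⌊x⌋₊ with hk
  have hk1 : 1 ≤ k := Nat.one_le_floor_iff _ |>.2 hx1
  have hkx : (k : ℝ) ≤ x := Nat.floor_le (by linarith)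
  have hk1' : (1 : ℝ) ≤ k := by exact_mod_cast hk1
  have hxk : x ≤ 2 * k := by
    have := Nat.lt_floor_add_one x
    rw [← hk] at this
    linarith
  refine ⟨hk1, hkx, ?_⟩
  have hlogx : Real.log x = l / 2 - Real.log l := by
    rw [hx, Real.log_div (by linarith) hl0.ne']
    linarith
  have h1 : Real.log k ≤ Real.log x := Real.log_le_log (by linarith) hkx
  have h2 : Real.log x ≤ Real.log 2 + Real.log k := by
    rw [← Real.log_mul two_ne_zero (by linarith)]
    exact Real.log_le_log (by linarith) hxk
  have hlogN : Real.log (k * n ^ 2) = Real.log k + l := by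
    rw [Real.log_mul (by linarith) (by positivity), hsq]
  have hlk : 0 ≤ Real.log k := Real.log_nonneg hk1'
  have hll : 0 ≤ Real.log l := Real.log_nonneg (by linarith)
  have h3 : Real.log l ≤ Real.log (Real.log k + l) := Real.log_le_log hl0 (by linarith)
  have h4 : Real.log (Real.log k + l) ≤ Real.log 2 + Real.log l := by
    rw [← Real.log_mul two_ne_zero hl0.ne']
    exact Real.log_le_log (by linarith) (by linarith)
  rw [hlogN]
  have := Real.log_two_lt_d9
  rw [abs_le]
  constructor <;> linarith

/-- The 6π comes from 1 + log(n+1) ≤ 3 log n together with 2k log n ≤ n, applied to the error in S;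
the 2 comes from the expansion of log k. -/
lemma abs_energy_sub_le {n E S : ℝ} {k : ℕ} (hn : 3 ≤ n) (hk : k = ⌊n / Real.log (n ^ 2)⌋₊)
    (hE : E = -(n ^ 2 * (k * Real.log k)) - (k : ℝ) ^ 2 / 2 * S)
    (hS : |S - n ^ 4 / 2| ≤ 8 * Real.pi * n * (1 + Real.log (n + 1))) :
    |E - (-((k * n ^ 2) ^ 2 / 4) - 1 / 3 * (k * n ^ 2) * Real.log (k * n ^ 2) +
      2 / 3 * (k * n ^ 2) * Real.log (Real.log (k * n ^ 2)))| ≤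
      (6 * Real.pi + 2) * (k * n ^ 2) := by
  obtain ⟨hk1, hkn, hlog⟩ := floor_div_log_sq hn
  rw [← hk] at hk1 hkn hlog
  have hpi := Real.pi_pos
  have hk0 : (1 : ℝ) ≤ k := by exact_mod_cast hk1
  have hl1 : 1 ≤ Real.log n := by
    rw [Real.le_log_iff_exp_le (by linarith)]
    linarith [Real.exp_one_lt_d9]
  have hln : Real.log (n + 1) ≤ 2 * Real.log n := by
    have : Real.log (n ^ 2) = 2 * Real.log n := by rw [Real.log_pow]; norm_num
    rw [← this]
    exact Real.log_le_log (by linarith) (by nlinarith)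
  have hkl : (k : ℝ) * (2 * Real.log n) ≤ n := by
    rwa [le_div_iff₀ (by linarith)] at hkn
  have h1 : (k : ℝ) ^ 2 / 2 * (8 * Real.pi * n * (1 + Real.log (n + 1))) ≤
      6 * Real.pi * (k * n ^ 2) := by
    calc _ ≤ (k : ℝ) ^ 2 / 2 * (8 * Real.pi * n * (3 * Real.log n)) := by
          gcongr
          linarith
      _ = 6 * Real.pi * k * n * (k * (2 * Real.log n)) := by ring
      _ ≤ 6 * Real.pi * k * n * n := by gcongr
      _ = _ := by ring
  have h2 : |(k : ℝ) ^ 2 / 2 * (S - n ^ 4 / 2)| ≤ 6 * Real.pi * (k * n ^ 2) := by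
    rw [abs_mul, abs_of_nonneg (by positivity)]
    exact (mul_le_mul_of_nonneg_left hS (by positivity)).trans h1
  have h3 : |(k * n ^ 2) * (Real.log k - 1 / 3 * Real.log (k * n ^ 2) +
      2 / 3 * Real.log (Real.log (k * n ^ 2)))| ≤ 2 * (k * n ^ 2) := by
    rw [abs_mul, abs_of_nonneg (by positivity), mul_comm 2]
    exact mul_le_mul_of_nonneg_left hlog (by positivity)
  have h4 : E - (-((k * n ^ 2) ^ 2 / 4) - 1 / 3 * (k * n ^ 2) * Real.log (k * n ^ 2) +
      2 / 3 * (k * n ^ 2) * Real.log (Real.log (k * n ^ 2))) =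
      -((k : ℝ) ^ 2 / 2 * (S - n ^ 4 / 2)) - (k * n ^ 2) * (Real.log k -
        1 / 3 * Real.log (k * n ^ 2) + 2 / 3 * Real.log (Real.log (k * n ^ 2))) := by
    rw [hE]; ring
  rw [h4, abs_le]
  rw [abs_le] at h2 h3
  constructor <;> linarith

end Asymptotics

end HopfLift

theorem corollary3p8
    (P : ∀ L : ℕ, MeasureTheory.Measure (Fin ((L + 1) ^ 2) → HopfLift.S2))
    (hP : ∀ L : ℕ, HopfLift.IsHarmonicEnsemble L (P L)) :
    (∀ L : ℕ, MeasureTheory.Integrable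
      (fun ω : (Fin ((L + 1) ^ 2) → HopfLift.S2) × (Fin ((L + 1) ^ 2) → ℝ) =>
        HopfLift.logEnergy (HopfLift.hopfLift (HopfLift.numFibre L) ω.1 ω.2))
      ((P L).prod (HopfLift.phaseLaw ((L + 1) ^ 2)))) ∧
    Asymptotics.IsBigO Filter.atTop
      (fun L : ℕ =>
        (∫ ω : (Fin ((L + 1) ^ 2) → HopfLift.S2) × (Fin ((L + 1) ^ 2) → ℝ),
            HopfLift.logEnergy (HopfLift.hopfLift (HopfLift.numFibre L) ω.1 ω.2)
            ∂((P L).prod (HopfLift.phaseLaw ((L + 1) ^ 2))))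
        - (-((HopfLift.numPoints L : ℝ) ^ 2 / 4)
            - 1 / 3 * (HopfLift.numPoints L : ℝ) * Real.log (HopfLift.numPoints L)
            + 2 / 3 * (HopfLift.numPoints L : ℝ) * Real.log (Real.log (HopfLift.numPoints L))))
      (fun L : ℕ => (HopfLift.numPoints L : ℝ)) := by
  have hprob : ∀ L, MeasureTheory.IsProbabilityMeasure (P L) := fun L => by
    obtain ⟨K, -, hD⟩ := hP L
    exact hD.prob
  -- Integrability holds for any number of points per fibre, including L = 0, where log r = 0 and
  -- division by zero makes k = 0.
  refine ⟨fun L => HopfLift.integrable_logEnergy_hopfLift _ (P L), ?_⟩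
  refine Asymptotics.IsBigO.of_bound (6 * Real.pi + 2) ?_
  -- From L = 2 on, n = L + 1 is at least 3, which ensures log n ≥ 1 and k ≥ 1.
  filter_upwards [Filter.eventually_ge_atTop 2] with L hL
  have hn : (3 : ℝ) ≤ (L : ℝ) + 1 := by
    have : (2 : ℝ) ≤ L := by exact_mod_cast hL
    linarith
  have hbase : (HopfLift.numBase L : ℝ) = ((L : ℝ) + 1) ^ 2 := by
    simp [HopfLift.numBase]
  have hpts : (HopfLift.numPoints L : ℝ) = (HopfLift.numFibre L : ℝ) * ((L : ℝ) + 1) ^ 2 := by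
    rw [HopfLift.numPoints, Nat.cast_mul, hbase]
  have hk : HopfLift.numFibre L = ⌊((L : ℝ) + 1) / Real.log (((L : ℝ) + 1) ^ 2)⌋₊ := by
    rw [HopfLift.numFibre, hbase, Real.sqrt_sq (by linarith)]
  have hS := HopfLift.integral_pairLog_sum_bounds (by omega : 1 ≤ L) (hP L)
  have hE := HopfLift.integral_logEnergy_hopfLift (HopfLift.numFibre L) (P L)
  rw [show (((L + 1) ^ 2 : ℕ) : ℝ) = ((L : ℝ) + 1) ^ 2 by push_cast; ring] at hE
  rw [show (L : ℝ) + 2 = (L : ℝ) + 1 + 1 by ring] at hS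
  rw [hpts, Real.norm_eq_abs, Real.norm_of_nonneg (by positivity)]
  exact HopfLift.abs_energy_sub_le hn hk hE hS
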